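/- Let $\mathbb F$ be an algebraically closed field, $G$ an abelian group (written multiplicatively), and $G^\#=G\times\mathbb Z_2$, with $G$ identified with $G\times\{\bar 0\}$. All algebras and modules are finite-dimensional over $\mathbb F$. For $m+n\ge 1$ let $M(m,n)=\operatorname{End}(\mathbb F^m\oplus\mathbb F^n)$ be the matrix superalgebra with its canonical $\mathbb Z_2$-grading (block-diagonal matrices are even, block-antidiagonal matrices are odd). A $G$-grading on a superalgebra is a grading of the underlying algebra by $G$ each of whose components is the sum of its even and odd parts; it amounts to a $G^\#$-grading. Two $G$-graded superalgebras are isomorphic if some algebra isomorphism preserves both the $\mathbb Z_2$-gradings and the $G$-gradings. A $G$-grading on $M(m,n)$ is called odd if, as a $G^\#$-graded algebra, $M(m,n)$ is isomorphic to $\operatorname{End}_{\mathcal D}(\mathcal U)$ for a $G^\#$-graded division algebra $\mathcal D$ with $\mathcal D^{\bar 1}\neq 0$ and a graded right $\mathcal D$-module $\mathcal U$. Consider triples $(T,\beta,\gamma)$ where $T$ is a finite subgroup of $G^\#$ not contained in $G$, $\beta:T\times T\to\mathbb F^\times$ is a nondegenerate alternating bicharacter, and $\gamma=(g_1,\dots,g_k)$,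 $k\ge 1$, is a tuple of elements of $G$. Choose a decomposition $T=A\times B$ with $\beta$ trivial on $A\times A$ and on $B\times B$, and let $\mathcal D=M_{|B|}(\mathbb F)$ be the graded division algebra (standard realization) whose component of degree $ab$ ($a\in A$, $b\in B$) is spanned by $X_{ab}=\sum_{b'\in B}\beta(a,bb')E_{bb',b'}$. Then $\Gamma(T,\beta,\gamma)$ denotes $M_k(\mathbb F)\otimes\mathcal D\cong M_{k\sqrt{|T|}}(\mathbb F)$ with the $G^\#$-grading $\deg(E_{ij}\otimes d)=g_i(\deg d)g_j^{-1}$, regarded as a $G$-graded superalgebra. Let $\Xi(\gamma)$ be the multiset of the cosets $g_1T,\dots,g_kT$ in $G^\#/T$. **Theorem.** 1. If $M(m,n)$, $m+n\ge 1$, admits an odd $G$-grading, then $m=n$, and every odd $G$-grading on $M(m,n)$ is isomorphic to some $\Gamma(T,\beta,\gamma)$ as above. 2. Conversely, for every $(T,\beta,\gamma)$ as above a decomposition $T=A\times B$ as above exists, and, for each such decomposition, $\Gamma(T,\beta,\gamma)$ is isomorphic to an odd $G$-grading on $M(n,n)$, where $2n=k\sqrt{|T|}$. 3. For all $(T,\beta,\gamma)$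 and $(T',\beta',\gamma')$ as above, and any choices of the decompositions, $\Gamma(T,\beta,\gamma)$ and $\Gamma(T',\beta',\gamma')$ are isomorphic if and only if $T=T'$, $\beta=\beta'$, and there is $g\in G$ such that $g\,\Xi(\gamma)=\Xi(\gamma')$. -/

import Mathlib

universe u v

open scoped MulOpposite Kronecker

noncomputable section

namespace SuperGrading

/-- The group `G × ℤ₂`, written multiplicatively. -/
abbrev Sharp (G : Type v) : Type v := G × Multiplicative (ZMod 2)

/-- The copy `G × {0}` of `G` inside `G × ℤ₂`. -/
def evenPart (G : Type v) [CommGroup G] : Subgroup (Sharp G) :=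
  (MonoidHom.snd G (Multiplicative (ZMod 2))).ker

section Gradings

variable {F : Type u} [Field F]

/-- `𝒜` is a grading of the algebra `A` by the group `H`. -/
structure IsGrading {H : Type*} [CommGroup H] {A : Type*} [Ring A] [Algebra F A]
    (𝒜 : H → Submodule F A) : Prop where
  bijective : letI := Classical.decEq H; DirectSum.IsInternal 𝒜
  mul_mem : ∀ (g h : H) (a b : A), a ∈ 𝒜 g → b ∈ 𝒜 h → a * b ∈ 𝒜 (g * h)

/-- `𝒜` is a `G`-grading of the superalgebra `A` whose canonical `ℤ₂`-grading is `par`: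
every component of `𝒜` is the direct sum of its even and its odd part. -/
structure IsSuperalgebraGrading {G : Type*} [CommGroup G] {A : Type*} [Ring A] [Algebra F A]
    (par : ZMod 2 → Submodule F A) (𝒜 : G → Submodule F A) : Prop where
  grading : IsGrading 𝒜
  compatible : ∀ g : G, 𝒜 g = (𝒜 g ⊓ par 0) ⊔ (𝒜 g ⊓ par 1)

/-- The `G × ℤ₂`-grading attached to a `G`-grading of a superalgebra. -/
def sharpGrading {G : Type*} {A : Type*} [Ring A] [Algebra F A]
    (par : ZMod 2 → Submodule F A) (𝒜 : G → Submodule F A) : Sharp G → Submodule F A :=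
  fun x => 𝒜 x.1 ⊓ par x.2.toAdd

/-- The `G`-grading obtained from a `G × ℤ₂`-grading by forgetting the second coordinate. -/
def groupComponents {G : Type*} {A : Type*} [Ring A] [Algebra F A]
    (ℬ : Sharp G → Submodule F A) : G → Submodule F A :=
  fun g => ⨆ i : ZMod 2, ℬ (g, Multiplicative.ofAdd i)

/-- The `ℤ₂`-grading obtained from a `G × ℤ₂`-grading by forgetting the first coordinate. -/
def parityComponents {G : Type*} {A : Type*} [Ring A] [Algebra F A]
    (ℬ : Sharp G → Submodule F A) : ZMod 2 → Submodule F A :=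
  fun i => ⨆ g : G, ℬ (g, Multiplicative.ofAdd i)

/-- Two `G`-graded superalgebras are isomorphic: some algebra isomorphism respects both the
canonical `ℤ₂`-gradings and the `G`-gradings. -/
def GradedSuperIso {G : Type*} {A B : Type*} [Ring A] [Algebra F A] [Ring B] [Algebra F B]
    (parA : ZMod 2 → Submodule F A) (𝒜 : G → Submodule F A)
    (parB : ZMod 2 → Submodule F B) (ℬ : G → Submodule F B) : Prop :=
  ∃ φ : A ≃ₐ[F] B,
    (∀ i : ZMod 2, (parA i).map φ.toLinearMap = parB i) ∧
    (∀ g : G, (𝒜 g).map φ.toLinearMap = ℬ g)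

/-- Graded division algebra: every nonzero homogeneous element is invertible. -/
structure IsGradedDivision {H : Type*} [CommGroup H] {D : Type*} [Ring D] [Algebra F D]
    (𝒟 : H → Submodule F D) : Prop where
  grading : IsGrading 𝒟
  nontrivial : Nontrivial D
  isUnit : ∀ (h : H) (d : D), d ∈ 𝒟 h → d ≠ 0 → IsUnit d

/-- `𝒰` makes the right `D`-module `U` a graded right module over the graded algebra `D`. -/
structure IsGradedRightModule {H : Type*} [CommGroup H] {D : Type*} [Ring D] [Algebra F D]
    {U : Type*} [AddCommGroup U] [Module F U] [Module Dᵐᵒᵖ U]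
    (𝒟 : H → Submodule F D) (𝒰 : H → Submodule F U) : Prop where
  bijective : letI := Classical.decEq H; DirectSum.IsInternal 𝒰
  smul_mem : ∀ (g h : H) (x : U) (d : D), x ∈ 𝒰 g → d ∈ 𝒟 h → MulOpposite.op d • x ∈ 𝒰 (g * h)

/-- The `D`-linear endomorphisms of the graded right `D`-module `U` that are homogeneous of
degree `g`. -/
def endComponent {H : Type*} [CommGroup H] {D : Type*} [Ring D] [Algebra F D]
    {U : Type*} [AddCommGroup U] [Module F U] [Module Dᵐᵒᵖ U] [IsScalarTower F Dᵐᵒᵖ U]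
    (𝒰 : H → Submodule F U) (g : H) : Submodule F (Module.End Dᵐᵒᵖ U) where
  carrier := {f | ∀ (h : H) (x : U), x ∈ 𝒰 h → f x ∈ 𝒰 (g * h)}
  add_mem' := fun ha hb h x hx => (𝒰 (g * h)).add_mem (ha h x hx) (hb h x hx)
  zero_mem' := fun h _ _ => (𝒰 (g * h)).zero_mem
  smul_mem' := fun c _ ha h x hx => (𝒰 (g * h)).smul_mem c (ha h x hx)

/-- Odd gradings of a (finite-dimensional) superalgebra: `A` with its `G × ℤ₂`-grading is
isomorphic to `End_D(U)` for a `G × ℤ₂`-graded division algebra `D` with nonzero odd part and a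
graded right `D`-module `U`. -/
def IsOddGrading {G : Type v} [CommGroup G] {A : Type u} [Ring A] [Algebra F A]
    (par : ZMod 2 → Submodule F A) (𝒜 : G → Submodule F A) : Prop :=
  IsSuperalgebraGrading par 𝒜 ∧
  ∃ (D : Type u) (_ : Ring D) (_ : Algebra F D) (_ : FiniteDimensional F D)
    (U : Type u) (_ : AddCommGroup U) (_ : Module F U) (_ : Module Dᵐᵒᵖ U)
    (_ : IsScalarTower F Dᵐᵒᵖ U) (_ : FiniteDimensional F U)
    (𝒟 : Sharp G → Submodule F D) (𝒰 : Sharp G → Submodule F U),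
    IsGradedDivision 𝒟 ∧ IsGradedRightModule 𝒟 𝒰 ∧
    parityComponents 𝒟 1 ≠ ⊥ ∧
    ∃ φ : A ≃ₐ[F] Module.End Dᵐᵒᵖ U,
      ∀ x : Sharp G, (sharpGrading par 𝒜 x).map φ.toLinearMap = endComponent 𝒰 x

end Gradings

section MatrixSuperalgebra

variable (F : Type u) [Field F] (m n : ℕ)

/-- The underlying algebra of the matrix superalgebra `M(m,n)`. -/
abbrev MatrixSuperalgebra : Type u := Matrix (Fin m ⊕ Fin n) (Fin m ⊕ Fin n) F

/-- The parity of the basis vectors of `F^m ⊕ F^n`. -/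
def indexParity : Fin m ⊕ Fin n → ZMod 2 := Sum.elim (fun _ => 0) (fun _ => 1)

/-- The canonical `ℤ₂`-grading of `M(m,n)`: even matrices are block diagonal, odd matrices are
block antidiagonal. -/
def canonicalParity (i : ZMod 2) : Submodule F (MatrixSuperalgebra F m n) where
  carrier := {M | ∀ a b, indexParity m n a - indexParity m n b ≠ i → M a b = 0}
  add_mem' := fun hM hN a b h => by simp [hM a b h, hN a b h]
  zero_mem' := fun _ _ _ => rfl
  smul_mem' := fun c _ hM a b h => by simp [hM a b h]

end MatrixSuperalgebra

section Parameters

/-- A pair `(T, β)`: a finite subgroup `T` of `H` and a nondegenerate alternating bicharacter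
`β` on `T` with values in `Fˣ`. -/
structure DivisionDatum (F : Type u) [Field F] (H : Type v) [CommGroup H] where
  T : Subgroup H
  finite : Finite T
  β : T →* T →* Fˣ
  alternating : ∀ t : T, β t t = 1
  nondegenerate : ∀ t : T, (∀ s : T, β t s = 1) → t = 1

/-- A decomposition `T = A × B` with `β` trivial on `A` and on `B`; it determines a standard
realization of the graded division algebra attached to `(T, β)`. -/
structure Polarization {F : Type u} [Field F] {H : Type v} [CommGroup H]
    (P : DivisionDatum F H) where
  A : Subgroup P.T
  B : Subgroup P.T
  complement : Subgroup.IsComplement' A B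
  trivial_A : ∀ a ∈ A, ∀ a' ∈ A, P.β a a' = 1
  trivial_B : ∀ b ∈ B, ∀ b' ∈ B, P.β b b' = 1

variable {F : Type u} [Field F] {H : Type v} [CommGroup H] {P : DivisionDatum F H}

instance Polarization.fintypeB (S : Polarization P) : Fintype S.B :=
  haveI := P.finite
  Fintype.ofFinite _

instance Polarization.decidableEqB (S : Polarization P) : DecidableEq S.B :=
  Classical.decEq _

/-- The matrix `X_{ab} = ∑_{b'} β(a, b b') E_{b b', b'}`, which spans the component of degree
`a b` of the standard realization. -/
def standardX (S : Polarization P) (a : S.A) (b : S.B) : Matrix S.B S.B F :=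
  ∑ b' : S.B, Matrix.single (b * b') b' ((P.β (a : P.T) ((b * b' : S.B) : P.T) : Fˣ) : F)

/-- The grading `Γ(T, β, γ)` of the matrix algebra `M_k(F) ⊗ 𝒟 = M_{k|B|}(F)`, where `𝒟` is the
standard realization given by `T = A × B`: the degree of `E_{ij} ⊗ X_t` is `γ_i t γ_j⁻¹`. -/
def matrixGrading (S : Polarization P) {k : ℕ} (γ : Fin k → H) (h : H) :
    Submodule F (Matrix (Fin k × S.B) (Fin k × S.B) F) :=
  Submodule.span F
    {M | ∃ (i j : Fin k) (a : S.A) (b : S.B),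
      γ i * (((a : P.T) * (b : P.T) : P.T) : H) * (γ j)⁻¹ = h ∧
      M = (Matrix.single i j (1 : F)) ⊗ₖ (standardX S a b)}

/-- The multiset `Ξ(γ)` of the cosets `γ_i T`. -/
def cosetMultiset (T : Subgroup H) {k : ℕ} (γ : Fin k → H) : Multiset (H ⧸ T) :=
  (Finset.univ : Finset (Fin k)).val.map (fun i => (γ i : H ⧸ T))

/-- The parameters `(T, β, γ)` of an odd grading: `T ⊆ G × ℤ₂` is not contained in `G`, and `γ`
is a nonempty tuple of elements of `G`. -/
structure OddDatum (F : Type u) [Field F] (G : Type v) [CommGroup G] extends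
    DivisionDatum F (Sharp G) where
  not_even : ¬ T ≤ evenPart G
  k : ℕ
  k_pos : 0 < k
  γ : Fin k → G

variable {G : Type v} [CommGroup G]

/-- The entries of `γ` regarded as elements of `G × ℤ₂`. -/
def OddDatum.γSharp (Q : OddDatum F G) : Fin Q.k → Sharp G := fun i => (Q.γ i, 1)

/-- `Γ(T, β, γ)` as a `G × ℤ₂`-grading of the matrix algebra. -/
def oddSharp (Q : OddDatum F G) (S : Polarization Q.toDivisionDatum) :
    Sharp G → Submodule F (Matrix (Fin Q.k × S.B) (Fin Q.k × S.B) F) :=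
  matrixGrading S Q.γSharp

/-- `Γ(T, β, γ)` as a `G`-grading; the canonical `ℤ₂`-grading is `oddParity Q S`. -/
def oddGrading (Q : OddDatum F G) (S : Polarization Q.toDivisionDatum) :
    G → Submodule F (Matrix (Fin Q.k × S.B) (Fin Q.k × S.B) F) :=
  groupComponents (oddSharp Q S)

/-- The canonical `ℤ₂`-grading of the superalgebra `M_k(F) ⊗ 𝒟`. -/
def oddParity (Q : OddDatum F G) (S : Polarization Q.toDivisionDatum) :
    ZMod 2 → Submodule F (Matrix (Fin Q.k × S.B) (Fin Q.k × S.B) F) :=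
  parityComponents (oddSharp Q S)

end Parameters

end SuperGrading

end

open SuperGrading

/-! Over an algebraically closed field the identity component of a finite-dimensional graded
division algebra 𝒟 is `F`. All components are therefore at most one-dimensional, the support `T` is
a finite group, and the commutation scalars form an alternating bicharacter `β`. A homogeneous
central element of 𝒟 acts centrally on the module, so centrality of `End_𝒟(𝒰)` makes `β`
nondegenerate. A graded module has a homogeneous basis, which turns `End_𝒟(𝒰)` into matrices over 𝒟
(`exists_end_algEquiv_matrix`). Multiplying basis vectors by an odd element of 𝒟 moves all degrees
into `G`.

The group `T` splits into isotropic subgroups by repeatedly removing hyperbolic pairs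
(`exists_isotropic_decomposition`). On each isotropic factor the homogeneous generators can be
rescaled to multiply like group elements, so every 𝒟 with data `(T, β)` is isomorphic to the
standard realization (`Realization.exists_algEquiv_standard`).

Nondegeneracy gives `t` in `T` for which `β(t, ·)` is the parity character. Suitably scaled, `1 ⊗
X_t` is an involution, and conjugation by it is the parity automorphism. An odd invertible element
exchanges its two eigenspaces, so the superalgebra is `M(n,n)`; the characteristic cannot be 2
because `T` has even order.

For uniqueness, an isomorphism of endomorphism algebras carries a homogeneous rank-one idempotent to
another one. Comparing the left ideals they generate gives a degree-shifting isomorphism of modules,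
compatible with a multiplicative map of the division algebras (`exists_shift_of_end_algEquiv`). This
recovers `T` and `β`, and the dimensions of the module components count the cosets in `Ξ(γ)`. An odd
shift can be made even, since `T` acts trivially on its cosets. -/

open SuperGrading

noncomputable section

namespace SuperGrading

/-! ### Homogeneous components of a graded vector space. -/

section Component

variable {F : Type*} [Field F] {H : Type*} [DecidableEq H] {V : Type*} [AddCommGroup V] [Module F V]
  {𝒱 : H → Submodule F V}

/-- The projection onto the component of degree `h`. -/
def component (hV : DirectSum.IsInternal 𝒱) (h : H) : V →ₗ[F] V :=
  (𝒱 h).subtype ∘ₗ DirectSum.component F H (fun h => 𝒱 h) h ∘ₗ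
    (LinearEquiv.ofBijective (DirectSum.coeLinearMap 𝒱) hV).symm.toLinearMap

theorem component_mem (hV : DirectSum.IsInternal 𝒱) (h : H) (x : V) : component hV h x ∈ 𝒱 h := by
  simp [component]

theorem component_of_mem (hV : DirectSum.IsInternal 𝒱) {h : H} {x : V} (hx : x ∈ 𝒱 h) (g : H) :
    component hV g x = if h = g then x else 0 := by
  have : (LinearEquiv.ofBijective (DirectSum.coeLinearMap 𝒱) hV).symm x =
      DirectSum.lof F H (fun h => 𝒱 h) h ⟨x, hx⟩ := by
    rw [LinearEquiv.symm_apply_eq]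
    exact (DirectSum.coeLinearMap_lof 𝒱 h ⟨x, hx⟩).symm
  simp only [component, LinearMap.comp_apply, LinearEquiv.coe_coe, this]
  split_ifs with hg
  · subst hg
    simp [DirectSum.component.lof_self]
  · rw [DirectSum.component.of]
    simp [hg]

theorem component_self (hV : DirectSum.IsInternal 𝒱) {h : H} {x : V} (hx : x ∈ 𝒱 h) :
    component hV h x = x := by
  rw [component_of_mem hV hx, if_pos rfl]

theorem component_ne (hV : DirectSum.IsInternal 𝒱) {g h : H} {x : V} (hx : x ∈ 𝒱 h) (hg : h ≠ g) :
    component hV g x = 0 := by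
  rw [component_of_mem hV hx, if_neg hg]

theorem mem_iff_component_eq (hV : DirectSum.IsInternal 𝒱) {h : H} {x : V} :
    x ∈ 𝒱 h ↔ component hV h x = x :=
  ⟨component_self hV, fun e => e ▸ component_mem hV h x⟩

theorem internal_induction (hV : DirectSum.IsInternal 𝒱) {p : V → Prop}
    (zero : p 0) (hom : ∀ h, ∀ x ∈ 𝒱 h, p x) (add : ∀ x y, p x → p y → p (x + y)) (x : V) : p x := by
  have hx : x ∈ iSup 𝒱 := by
    rw [((DirectSum.isInternal_submodule_iff_iSupIndep_and_iSup_eq_top _).1 hV).2]; trivial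
  exact Submodule.iSup_induction 𝒱 (motive := p) hx hom zero add

theorem eq_of_component_eq (hV : DirectSum.IsInternal 𝒱) {x y : V}
    (hxy : ∀ h, component hV h x = component hV h y) : x = y := by
  apply (LinearEquiv.ofBijective (DirectSum.coeLinearMap 𝒱) hV).symm.injective
  apply DFinsupp.ext
  intro h
  exact Subtype.ext (hxy h)

theorem eq_zero_of_component_eq_zero (hV : DirectSum.IsInternal 𝒱) {x : V}
    (hx : ∀ h, component hV h x = 0) : x = 0 :=
  eq_of_component_eq hV fun h => by rw [hx, map_zero]

end Component

/-! ### Gradings defined by assigning degrees to a basis. -/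

section BasisGrading

variable {F : Type*} [Field F] {V : Type*} [AddCommGroup V] [Module F V]
  {ι : Type*} (b : Module.Basis ι F V)

theorem Basis.span_image_inf (s t : Set ι) :
    Submodule.span F (b '' s) ⊓ Submodule.span F (b '' t) = Submodule.span F (b '' (s ∩ t)) := by
  ext x
  simp [b.mem_span_image]

theorem Basis.iSup_span_image {κ : Sort*} (s : κ → Set ι) :
    ⨆ k, Submodule.span F (b '' s k) = Submodule.span F (b '' ⋃ k, s k) := by
  rw [Set.image_iUnion, Submodule.span_iUnion]

theorem Basis.isInternal_span_image {H : Type*} [DecidableEq H] (deg : ι → H) :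
    DirectSum.IsInternal (fun h => Submodule.span F (b '' {i | deg i = h})) := by
  rw [DirectSum.isInternal_submodule_iff_iSupIndep_and_iSup_eq_top]
  constructor
  · intro h
    rw [disjoint_iff]
    simp_rw [iSup_subtype', Basis.iSup_span_image, Basis.span_image_inf]
    rw [show {i | deg i = h} ∩ _ = (∅ : Set ι) from ?_]
    · simp
    · ext i
      simp only [Set.mem_inter_iff, Set.mem_ofPred_eq, Set.mem_iUnion, Set.mem_empty_iff_false,
        iff_false, not_and, not_exists]
      rintro rfl k
      exact fun e => k.2 e.symm
  · rw [Basis.iSup_span_image, show (⋃ h, {i | deg i = h}) = Set.univ by ext; simp]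
    simp

end BasisGrading

/-! ### Graded algebras, graded division algebras and graded modules. -/

section Graded

variable {F : Type*} [Field F] {H : Type*}

theorem isInternal_of_projections [DecidableEq H] {V : Type*} [AddCommGroup V] [Module F V]
    {𝒱 : H → Submodule F V} (π : H → V →ₗ[F] V)
    (self : ∀ h, ∀ x ∈ 𝒱 h, π h x = x) (other : ∀ g h, g ≠ h → ∀ x ∈ 𝒱 g, π h x = 0)
    (top : ⨆ h, 𝒱 h = ⊤) : DirectSum.IsInternal 𝒱 := by
  rw [DirectSum.isInternal_submodule_iff_iSupIndep_and_iSup_eq_top]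
  refine ⟨fun h => ?_, top⟩
  rw [Submodule.disjoint_def]
  intro x hx hx'
  have : ⨆ g, ⨆ (_ : g ≠ h), 𝒱 g ≤ LinearMap.ker (π h) :=
    iSup₂_le fun g hg y hy => other g h hg y hy
  rw [← self h x hx]
  exact this hx'

variable [CommGroup H]

section Algebra

variable {A : Type*} [Ring A] [Algebra F A] {𝒜 : H → Submodule F A}

theorem IsGrading.isInternal [DecidableEq H] (h𝒜 : IsGrading 𝒜) : DirectSum.IsInternal 𝒜 := by
  convert h𝒜.bijective

theorem IsGrading.component_mul [DecidableEq H] (h𝒜 : IsGrading 𝒜) {g : H} {y : A} (hy : y ∈ 𝒜 g)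
    (h : H) (x : A) :
    component h𝒜.isInternal (h * g) (x * y) = component h𝒜.isInternal h x * y := by
  induction x using internal_induction h𝒜.isInternal with
  | zero => simp
  | hom k x hx =>
    rw [component_of_mem _ (h𝒜.mul_mem _ _ _ _ hx hy), component_of_mem _ hx]
    simp only [mul_left_inj]
    split_ifs <;> simp
  | add x x' hx hx' => simp [add_mul, hx, hx']

/-- The degree-one component of `1` acts as a left identity on every homogeneous element, hence on
everything, so it equals `1`. -/
theorem IsGrading.one_mem (h𝒜 : IsGrading 𝒜) : (1 : A) ∈ 𝒜 1 := by
  classical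
  have key : ∀ x : A, component h𝒜.isInternal 1 1 * x = x := by
    intro x
    induction x using internal_induction h𝒜.isInternal with
    | zero => simp
    | hom g x hx =>
      rw [← h𝒜.component_mul hx, one_mul, one_mul, component_self _ hx]
    | add x x' hx hx' => rw [mul_add, hx, hx']
  rw [mem_iff_component_eq h𝒜.isInternal]
  simpa using key 1

end Algebra

section Division

variable {D : Type*} [Ring D] [Algebra F D] {𝒟 : H → Submodule F D}

/-- In `u⁻¹ * u = 1` only the component of `u⁻¹` of degree `t⁻¹` contributes to degree one; that
component is already a left inverse, so it is `u⁻¹`. -/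
theorem IsGradedDivision.exists_inverse (h𝒟 : IsGradedDivision 𝒟) {t : H} {d : D} (hd : d ∈ 𝒟 t)
    (h0 : d ≠ 0) : ∃ c ∈ 𝒟 t⁻¹, d * c = 1 ∧ c * d = 1 := by
  classical
  obtain ⟨u, rfl⟩ := h𝒟.isUnit t d hd h0
  have h := h𝒟.grading.component_mul hd t⁻¹ (↑u⁻¹ : D)
  rw [Units.inv_mul, inv_mul_cancel, component_self _ h𝒟.grading.one_mem] at h
  have h' : (↑u⁻¹ : D) = component h𝒟.grading.isInternal t⁻¹ (↑u⁻¹ : D) := by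
    exact Units.inv_eq_of_mul_eq_one_left h.symm
  exact ⟨↑u⁻¹, h' ▸ component_mem _ _ _, by simp, by simp⟩

theorem IsGradedDivision.mul_ne_zero (h𝒟 : IsGradedDivision 𝒟) {t s : H} {d e : D} (hd : d ∈ 𝒟 t)
    (hd0 : d ≠ 0) (he : e ∈ 𝒟 s) (he0 : e ≠ 0) : d * e ≠ 0 := by
  have := h𝒟.nontrivial
  exact ((h𝒟.isUnit _ _ hd hd0).mul (h𝒟.isUnit _ _ he he0)).ne_zero

/-- Subtracting `d` from a point `c` of its spectrum leaves a non-invertible element of degree one,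
which must vanish. -/
theorem IsGradedDivision.eq_algebraMap [IsAlgClosed F] [FiniteDimensional F D]
    (h𝒟 : IsGradedDivision 𝒟) {d : D} (hd : d ∈ 𝒟 1) : ∃ c : F, d = algebraMap F D c := by
  have := h𝒟.nontrivial
  obtain ⟨c, hc⟩ := spectrum.nonempty_of_isAlgClosed_of_finiteDimensional F d
  refine ⟨c, ?_⟩
  by_contra hne
  refine (spectrum.mem_iff.1 hc) (h𝒟.isUnit 1 _ ?_ ?_)
  · rw [Algebra.algebraMap_eq_smul_one]
    exact sub_mem (Submodule.smul_mem _ _ h𝒟.grading.one_mem) hd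
  · rw [sub_ne_zero]
    exact fun e => hne e.symm

theorem IsGradedDivision.eq_smul [IsAlgClosed F] [FiniteDimensional F D]
    (h𝒟 : IsGradedDivision 𝒟) {t : H} {d e : D} (hd : d ∈ 𝒟 t) (hd0 : d ≠ 0) (he : e ∈ 𝒟 t) :
    ∃ c : F, e = c • d := by
  obtain ⟨i, hi, hdi, hid⟩ := h𝒟.exists_inverse hd hd0
  have : e * i ∈ 𝒟 1 := by simpa using h𝒟.grading.mul_mem _ _ _ _ he hi
  obtain ⟨c, hc⟩ := h𝒟.eq_algebraMap this
  refine ⟨c, ?_⟩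
  rw [Algebra.smul_def, ← hc, mul_assoc, hid, mul_one]

end Division

section Module

variable {D : Type*} [Ring D] [Algebra F D] {𝒟 : H → Submodule F D}
  {U : Type*} [AddCommGroup U] [Module F U] [Module Dᵐᵒᵖ U]
  {𝒰 : H → Submodule F U}

theorem IsGradedRightModule.isInternal [DecidableEq H] (h𝒰 : IsGradedRightModule 𝒟 𝒰) :
    DirectSum.IsInternal 𝒰 := by
  convert h𝒰.bijective

theorem IsGradedRightModule.component_smul_left [DecidableEq H] (h𝒟 : IsGrading 𝒟)
    (h𝒰 : IsGradedRightModule 𝒟 𝒰) {g : H} {x : U} (hx : x ∈ 𝒰 g) (h : H) (d : D) :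
    component h𝒰.isInternal (g * h) (MulOpposite.op d • x) =
      MulOpposite.op (component h𝒟.isInternal h d) • x := by
  induction d using internal_induction h𝒟.isInternal with
  | zero => simp
  | hom k d hd =>
    rw [component_of_mem _ (h𝒰.smul_mem _ _ _ _ hx hd), component_of_mem _ hd]
    simp only [mul_right_inj]
    split_ifs <;> simp
  | add d d' hd hd' => simp [add_smul, hd, hd']

theorem IsGradedRightModule.component_smul_right [DecidableEq H]
    (h𝒰 : IsGradedRightModule 𝒟 𝒰) {g : H} {d : D} (hd : d ∈ 𝒟 g) (h : H) (x : U) :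
    component h𝒰.isInternal (h * g) (MulOpposite.op d • x) =
      MulOpposite.op d • component h𝒰.isInternal h x := by
  induction x using internal_induction h𝒰.isInternal with
  | zero => simp
  | hom k x hx =>
    rw [component_of_mem _ (h𝒰.smul_mem _ _ _ _ hx hd), component_of_mem _ hx]
    simp only [mul_left_inj]
    split_ifs <;> simp
  | add d d' hd hd' => simp [hd, hd']

/-- A finite-dimensional graded module over a graded division algebra is free on a homogeneous
basis. -/
theorem IsGradedRightModule.exists_homogeneous_basis [IsScalarTower F Dᵐᵒᵖ U]
    [FiniteDimensional F U]
    (h𝒟 : IsGradedDivision 𝒟) (h𝒰 : IsGradedRightModule 𝒟 𝒰) :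
    ∃ (k : ℕ) (u : Module.Basis (Fin k) Dᵐᵒᵖ U) (γ : Fin k → H), ∀ i, u i ∈ 𝒰 (γ i) := by
  classical
  have := h𝒟.nontrivial
  let v : {x : U // ∃ h, x ∈ 𝒰 h} → U := Subtype.val
  obtain ⟨s, hs, hmax⟩ := exists_maximal_linearIndepOn Dᵐᵒᵖ v
  set N := Submodule.span Dᵐᵒᵖ (v '' s) with hN
  -- The span of homogeneous vectors is a graded submodule.
  have hgr : ∀ x ∈ N, ∀ h, component h𝒰.isInternal h x ∈ N := by
    intro x hx
    induction hx using Submodule.span_induction with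
    | mem x hx =>
      intro h
      obtain ⟨⟨x, g, hxg⟩, hxs, rfl⟩ := hx
      rw [component_of_mem _ hxg]
      split_ifs
      · exact Submodule.subset_span ⟨_, hxs, rfl⟩
      · exact zero_mem _
    | zero => simp
    | add x y _ _ hx hy => intro h; rw [map_add]; exact add_mem (hx h) (hy h)
    | smul a x _ hx =>
      induction a using MulOpposite.rec' with | _ d
      induction d using internal_induction h𝒟.grading.isInternal with
      | zero => simp
      | hom g d hd =>
        intro h
        have := h𝒰.component_smul_right hd (h * g⁻¹) x
        rw [inv_mul_cancel_right] at this
        rw [this]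
        exact N.smul_mem _ (hx _)
      | add d d' hd hd' =>
        intro h
        rw [MulOpposite.op_add, add_smul, map_add]
        exact add_mem (hd h) (hd' h)
  have hhom : ∀ h, ∀ x ∈ 𝒰 h, x ∈ N := by
    intro g x hx
    by_cases hxs : (⟨x, g, hx⟩ : {x : U // ∃ h, x ∈ 𝒰 h}) ∈ s
    · exact Submodule.subset_span ⟨_, hxs, rfl⟩
    -- Maximality only gives a nonzero multiple of `x` in `N`. Since `N` is graded, a nonzero
    -- homogeneous component of the scalar works as well, and it is invertible.
    obtain ⟨a, ha, hax⟩ := hmax _ hxs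
    obtain ⟨h, hh⟩ : ∃ h, component h𝒟.grading.isInternal h a.unop ≠ 0 := by
      by_contra! hcon
      exact ha (MulOpposite.unop_injective (eq_zero_of_component_eq_zero _ hcon))
    have h1 := hgr _ hax (g * h)
    have h2 := h𝒰.component_smul_left h𝒟.grading hx h a.unop
    rw [MulOpposite.op_unop] at h2
    change component _ _ (a • x) ∈ N at h1
    rw [h2] at h1
    obtain ⟨c, -, hc, -⟩ := h𝒟.exists_inverse (component_mem _ h a.unop) hh
    have h3 := N.smul_mem (MulOpposite.op c) h1
    rwa [smul_smul, ← MulOpposite.op_mul, hc, MulOpposite.op_one, one_smul] at h3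
  have htop : N = ⊤ := by
    rw [eq_top_iff]
    rintro x -
    exact internal_induction h𝒰.isInternal (zero_mem _) hhom (fun _ _ => add_mem) x
  have hfin : Finite s := by
    -- Independence over `D` implies independence over `F`, so finite dimension bounds the basis.
    have hF : LinearIndependent F (fun x : s => v x) := by
      refine LinearIndependent.restrict_scalars (K := Dᵐᵒᵖ) ?_ hs
      intro a b hab
      have : FaithfulSMul F Dᵐᵒᵖ := inferInstance
      exact FaithfulSMul.algebraMap_injective F Dᵐᵒᵖ
        (by simpa [Algebra.algebraMap_eq_smul_one] using hab)
    exact hF.finite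
  let e := Finite.equivFin s
  let b : Module.Basis s Dᵐᵒᵖ U := Module.Basis.mk (v := fun x : s => v x) hs (by
    rw [← htop, hN, Set.image_eq_range])
  refine ⟨_, b.reindex e, fun i => (e.symm i).1.2.choose, fun i => ?_⟩
  rw [Module.Basis.reindex_apply, show b (e.symm i) = v (e.symm i) from
    Module.Basis.mk_apply _ _ _]
  exact (e.symm i).1.2.choose_spec

section Coordinates

variable {k : Type*} [Fintype k] {u : Module.Basis k Dᵐᵒᵖ U} {γ : k → H}

theorem IsGradedRightModule.mem_iff_repr_mem (h𝒟 : IsGrading 𝒟)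
    (h𝒰 : IsGradedRightModule 𝒟 𝒰) (hu : ∀ i, u i ∈ 𝒰 (γ i)) {g : H} {x : U} :
    x ∈ 𝒰 g ↔ ∀ i, (u.repr x i).unop ∈ 𝒟 ((γ i)⁻¹ * g) := by
  classical
  constructor
  · intro hx i
    have h1 : component h𝒰.isInternal g x = ∑ i, MulOpposite.op
        (component h𝒟.isInternal ((γ i)⁻¹ * g) (u.repr x i).unop) • u i := by
      conv_lhs => rw [← u.sum_repr x]
      rw [map_sum]
      refine Finset.sum_congr rfl fun i _ => ?_
      rw [← h𝒰.component_smul_left h𝒟 (hu i), mul_inv_cancel_left, MulOpposite.op_unop]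
    rw [component_self _ hx] at h1
    rw [mem_iff_component_eq h𝒟.isInternal]
    conv_rhs => rw [h1]
    rw [u.repr_sum_self, MulOpposite.unop_op]
  · intro h
    rw [← u.sum_repr x]
    refine sum_mem fun i _ => ?_
    simpa using h𝒰.smul_mem _ _ _ _ (hu i) (h i)

theorem mem_endComponent_iff [IsScalarTower F Dᵐᵒᵖ U] (h𝒟 : IsGrading 𝒟)
    (h𝒰 : IsGradedRightModule 𝒟 𝒰) (hu : ∀ i, u i ∈ 𝒰 (γ i)) {h : H} {f : Module.End Dᵐᵒᵖ U} :
    f ∈ endComponent 𝒰 h ↔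
      ∀ i j, (u.repr (f (u j)) i).unop ∈ 𝒟 ((γ i)⁻¹ * (h * γ j)) := by
  constructor
  · intro hf i j
    exact (h𝒰.mem_iff_repr_mem h𝒟 hu).1 (hf _ _ (hu j)) i
  · intro hf g x hx
    rw [← u.sum_repr x, map_sum]
    refine sum_mem fun j _ => ?_
    rw [map_smul]
    have h1 := (h𝒰.mem_iff_repr_mem h𝒟 hu).2 (fun i => hf i j)
    have h2 := h𝒰.smul_mem _ _ _ _ h1 ((h𝒰.mem_iff_repr_mem h𝒟 hu).1 hx j)
    simpa [mul_assoc] using h2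

end Coordinates

/-- The grading of the free right module with basis in degrees `γ i`. -/
def freeGrading (𝒟 : H → Submodule F D) {k : Type*} (γ : k → H) (h : H) :
    Submodule F (k → Dᵐᵒᵖ) where
  carrier := {x | ∀ i, (x i).unop ∈ 𝒟 ((γ i)⁻¹ * h)}
  add_mem' := fun ha hb i => add_mem (ha i) (hb i)
  zero_mem' := fun _ => zero_mem _
  smul_mem' := fun c _ ha i => Submodule.smul_mem _ c (ha i)

theorem isGradedRightModule_freeGrading (h𝒟 : IsGrading 𝒟) {k : Type*} [Fintype k]
    [DecidableEq k] (γ : k → H) : IsGradedRightModule 𝒟 (freeGrading 𝒟 γ) := by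
  classical
  refine ⟨?_, ?_⟩
  · refine isInternal_of_projections (fun h =>
      LinearMap.pi fun i => (MulOpposite.opLinearEquiv F).toLinearMap ∘ₗ
        component h𝒟.isInternal ((γ i)⁻¹ * h) ∘ₗ (MulOpposite.opLinearEquiv F).symm.toLinearMap ∘ₗ
        LinearMap.proj i) ?_ ?_ ?_
    · intro h x hx
      ext i
      simp [component_self _ (hx i)]
    · intro g h hgh x hx
      ext i
      have : (γ i)⁻¹ * g ≠ (γ i)⁻¹ * h := by simpa using hgh
      simp [component_ne _ (hx i) this]
    · rw [eq_top_iff]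
      rintro x -
      rw [← Finset.univ_sum_single x]
      refine sum_mem fun i _ => ?_
      generalize x i = d
      induction d using MulOpposite.rec' with | _ d
      induction d using internal_induction h𝒟.isInternal with
      | zero => simp
      | hom g d hd =>
        refine Submodule.mem_iSup_of_mem (γ i * g) fun j => ?_
        rcases eq_or_ne j i with rfl | hj
        · simpa using hd
        · simp [hj]
      | add d d' hd hd' =>
        rw [MulOpposite.op_add, Pi.single_add]
        exact add_mem hd hd'
  · intro g h x d hx hd i
    simpa [mul_assoc] using h𝒟.mul_mem _ _ _ _ (hx i) hd

theorem basisFun_mem_freeGrading (h𝒟 : IsGrading 𝒟) {k : Type*} [Fintype k] [DecidableEq k]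
    (γ : k → H) (i : k) : Pi.basisFun Dᵐᵒᵖ k i ∈ freeGrading 𝒟 γ (γ i) := by
  intro j
  rcases eq_or_ne j i with rfl | hj
  · simpa using h𝒟.one_mem
  · simp [hj]

end Module

end Graded

/-! ### Bicharacter data and their realizations by graded division algebras. -/

section Datum

variable {F : Type*} [Field F] {H : Type*} [CommGroup H]

theorem DivisionDatum.beta_mul_beta_swap (P : DivisionDatum F H) (s t : P.T) :
    P.β s t * P.β t s = 1 := by
  have h := P.alternating (s * t)
  simpa [P.alternating] using h

theorem DivisionDatum.beta_swap (P : DivisionDatum F H) (s t : P.T) :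
    P.β s t = (P.β t s)⁻¹ :=
  eq_inv_of_mul_eq_one_left (P.beta_mul_beta_swap s t)

/-- A graded algebra with one-dimensional components spanned by invertible elements, whose support
and commutation relations are given by `P`. -/
structure Realization (P : DivisionDatum F H) {D : Type*} [Ring D] [Algebra F D]
    (𝒟 : H → Submodule F D) where
  X : Module.Basis P.T F D
  isUnit : ∀ t, IsUnit (X t)
  mul : ∀ s t, ∃ c : F, X s * X t = c • X (s * t)
  comm : ∀ s t, X s * X t = (P.β s t : F) • (X t * X s)
  span : ∀ h, 𝒟 h = Submodule.span F (X '' {t | (t : H) = h})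

namespace Realization

variable {P : DivisionDatum F H} {D : Type*} [Ring D] [Algebra F D] {𝒟 : H → Submodule F D}

theorem finiteDimensional (R : Realization P 𝒟) : FiniteDimensional F D :=
  haveI := P.finite
  Module.Finite.of_basis R.X

theorem component_eq (R : Realization P 𝒟) (t : P.T) : 𝒟 t = Submodule.span F {R.X t} := by
  rw [R.span, show {s : P.T | (s : H) = t} = {t} by ext; simp, Set.image_singleton]

theorem component_eq_bot (R : Realization P 𝒟) {h : H} (hh : h ∉ P.T) : 𝒟 h = ⊥ := by
  rw [R.span, show {s : P.T | (s : H) = h} = ∅ from ?_, Set.image_empty, Submodule.span_empty]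
  ext s
  simp only [Set.mem_ofPred_eq, Set.mem_empty_iff_false, iff_false]
  rintro rfl
  exact hh s.2

theorem X_mem (R : Realization P 𝒟) (t : P.T) : R.X t ∈ 𝒟 t := by
  rw [R.component_eq]
  exact Submodule.mem_span_singleton_self _

theorem mem_component (R : Realization P 𝒟) {h : H} {d : D} (hd : d ∈ 𝒟 h) (hd0 : d ≠ 0) :
    ∃ (t : P.T) (c : F), (t : H) = h ∧ c ≠ 0 ∧ d = c • R.X t := by
  by_cases hh : h ∈ P.T
  · rw [R.component_eq ⟨h, hh⟩, Submodule.mem_span_singleton] at hd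
    obtain ⟨c, rfl⟩ := hd
    exact ⟨⟨h, hh⟩, c, rfl, fun h0 => hd0 (by simp [h0]), rfl⟩
  · rw [R.component_eq_bot hh, Submodule.mem_bot] at hd
    exact absurd hd hd0

theorem isGradedDivision (R : Realization P 𝒟) : IsGradedDivision 𝒟 where
  grading :=
    { bijective := by
        rw [funext R.span]
        exact @Basis.isInternal_span_image _ _ _ _ _ _ R.X _ (Classical.decEq H) (fun t => (t : H))
      mul_mem := by
        intro g h a b ha hb
        by_cases ha0 : a = 0
        · simp [ha0]
        by_cases hb0 : b = 0
        · simp [hb0]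
        obtain ⟨s, c, rfl, -, rfl⟩ := R.mem_component ha ha0
        obtain ⟨t, e, rfl, -, rfl⟩ := R.mem_component hb hb0
        obtain ⟨k, hk⟩ := R.mul s t
        rw [smul_mul_smul_comm, hk, smul_smul]
        exact Submodule.smul_mem _ _ (R.X_mem (s * t)) }
  nontrivial := ⟨R.X 1, 0, R.X.ne_zero 1⟩
  isUnit := by
    intro h d hd hd0
    obtain ⟨t, c, -, hc, rfl⟩ := R.mem_component hd hd0
    rw [Algebra.smul_def]
    exact ((isUnit_iff_ne_zero.2 hc).map (algebraMap F D)).mul (R.isUnit t)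

theorem component_ne_bot_iff (R : Realization P 𝒟) {h : H} : 𝒟 h ≠ ⊥ ↔ h ∈ P.T := by
  refine ⟨fun hb => by_contra fun hh => hb (R.component_eq_bot hh), fun hh => ?_⟩
  rw [R.component_eq ⟨h, hh⟩, Ne, Submodule.span_singleton_eq_bot]
  exact R.X.ne_zero _

theorem comm_of_mem (R : Realization P 𝒟) {s t : P.T} {x y : D} (hx : x ∈ 𝒟 s) (hy : y ∈ 𝒟 t) :
    x * y = (P.β s t : F) • (y * x) := by
  rw [R.component_eq, Submodule.mem_span_singleton] at hx hy
  obtain ⟨c, rfl⟩ := hx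
  obtain ⟨d, rfl⟩ := hy
  rw [smul_mul_smul_comm, smul_mul_smul_comm, R.comm, smul_comm, mul_comm c d]

/-- Transport of a realization along an isomorphism of algebras. -/
def map (R : Realization P 𝒟) {D' : Type*} [Ring D'] [Algebra F D'] (ψ : D ≃ₐ[F] D') :
    Realization P (fun h => (𝒟 h).map ψ.toLinearMap) where
  X := R.X.map ψ.toLinearEquiv
  isUnit t := (R.isUnit t).map ψ
  mul s t := by
    obtain ⟨c, hc⟩ := R.mul s t
    refine ⟨c, ?_⟩
    simp only [Module.Basis.map_apply, AlgEquiv.toLinearEquiv_apply]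
    rw [← map_mul, hc, map_smul]
  comm s t := by
    simp only [Module.Basis.map_apply, AlgEquiv.toLinearEquiv_apply]
    rw [← map_mul, R.comm, map_smul, map_mul]
  span h := by
    rw [R.span, Submodule.map_span, ← Set.image_comp]
    rfl

end Realization

end Datum

/-! ### Rescaling commuting generators into a group homomorphism. -/

section Characters

theorem exists_algHom_of_isAlgClosed (F : Type*) [Field F] [IsAlgClosed F] (E : Type*) [CommRing E]
    [Algebra F E] [Nontrivial E] [FiniteDimensional F E] : Nonempty (E →ₐ[F] F) := by
  obtain ⟨M, hM⟩ := Ideal.exists_maximal E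
  let _ := Ideal.Quotient.field M
  have hb : Function.Bijective (Algebra.ofId F (E ⧸ M)) :=
    IsAlgClosed.algebraMap_bijective_of_isIntegral
  exact ⟨(AlgEquiv.ofBijective _ hb).symm.toAlgHom.comp (Ideal.Quotient.mkₐ F M)⟩

open scoped IsMulCommutative in
-- The `y a` generate a commutative subalgebra, which has a character `χ` to `F`. It is nonzero on
-- each `y a`, and dividing `y a` by `χ (y a)` turns all structure constants into `1`.
theorem exists_rescaling_multiplicative {F : Type*} [Field F] [IsAlgClosed F] {D : Type*} [Ring D]
    [Algebra F D] [Nontrivial D] [FiniteDimensional F D] {A : Type*} [CommGroup A] (y : A → D)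
    (unit : ∀ a, IsUnit (y a)) (mul : ∀ a b, ∃ c : F, y a * y b = c • y (a * b))
    (comm : ∀ a b, y a * y b = y b * y a) :
    ∃ c : A → Fˣ, ∀ a b, (c a • y a) * (c b • y b) = c (a * b) • y (a * b) := by
  have : IsMulCommutative (Algebra.adjoin F (Set.range y)) :=
    Algebra.isMulCommutative_adjoin F (by
      rintro _ ⟨a, rfl⟩ _ ⟨b, rfl⟩
      exact comm a b)
  obtain ⟨χ⟩ := exists_algHom_of_isAlgClosed F (Algebra.adjoin F (Set.range y))
  let z : A → Algebra.adjoin F (Set.range y) := fun a => ⟨y a, Algebra.subset_adjoin ⟨a, rfl⟩⟩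
  have hz : ∀ a, ((z a : Algebra.adjoin F (Set.range y)) : D) = y a := fun _ => rfl
  have hmul : ∀ (a b : A) (c : F), y a * y b = c • y (a * b) →
      χ (z a) * χ (z b) = c * χ (z (a * b)) := by
    intro a b c h
    have : z a * z b = c • z (a * b) := Subtype.ext h
    rw [← map_mul, this, map_smul, smul_eq_mul]
  have hone : ∃ c : F, y 1 = algebraMap F D c := by
    obtain ⟨c, hc⟩ := mul 1 1
    refine ⟨c, ?_⟩
    rw [mul_one, Algebra.smul_def] at hc
    exact (unit 1).mul_right_cancel hc
  have hne : ∀ a, χ (z a) ≠ 0 := by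
    intro a h0
    obtain ⟨c, hc⟩ := mul a a⁻¹
    obtain ⟨c', hc'⟩ := hone
    rw [mul_inv_cancel, hc', Algebra.smul_def, ← map_mul] at hc
    have h1 : z a * z a⁻¹ = algebraMap F _ (c * c') := Subtype.ext hc
    have h2 := congrArg χ h1
    rw [map_mul, h0, zero_mul, AlgHom.commutes, Algebra.algebraMap_self, RingHom.id_apply] at h2
    have h3 := (unit a).mul (unit a⁻¹)
    rw [hc, ← h2, map_zero] at h3
    exact not_isUnit_zero h3
  refine ⟨fun a => (Units.mk0 _ (hne a))⁻¹, fun a b => ?_⟩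
  obtain ⟨k, hk⟩ := mul a b
  have h := hmul a b k hk
  simp only [Units.smul_def, Units.val_inv_eq_inv_val, Units.val_mk0]
  rw [smul_mul_smul_comm, hk, smul_smul]
  congr 1
  have := hne a; have := hne b; have := hne (a * b)
  field_simp
  linear_combination -h

end Characters

/-! ### The standard realization and its universality. -/

section Standard

variable {F : Type*} [Field F] {H : Type*} [CommGroup H] {P : DivisionDatum F H}

theorem standardX_apply (S : Polarization P) (a : S.A) (b i j : S.B) :
    standardX S a b i j = if i = b * j then ((P.β (a : P.T) (i : P.T) : Fˣ) : F) else 0 := by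
  classical
  rw [standardX, Matrix.sum_apply]
  simp only [Matrix.single_apply]
  rw [Finset.sum_eq_single j]
  · simp only [and_true, eq_comm (a := b * j)]
    split_ifs with h
    · rw [h]
    · rfl
  · intro c _ hc
    simp [hc]
  · simp

theorem standardX_mul (S : Polarization P) (a a' : S.A) (b b' : S.B) :
    standardX S a b * standardX S a' b' =
      ((P.β (b : P.T) (a' : P.T) : Fˣ) : F) • standardX S (a * a') (b * b') := by
  ext i j
  rw [Matrix.mul_apply, Matrix.smul_apply]
  simp only [standardX_apply]
  rw [Finset.sum_eq_single (b' * j)]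
  · simp only [if_true, ← mul_assoc]
    split_ifs with h
    · rw [smul_eq_mul, ← Units.val_mul, ← Units.val_mul, h]
      congr 1
      simp only [Subgroup.coe_mul, map_mul, MonoidHom.mul_apply]
      rw [P.beta_swap (b : P.T) (a' : P.T)]
      simp only [mul_comm, mul_left_comm, mul_assoc]
      simp
      rw [← mul_assoc (P.β (a' : P.T) (b' : P.T)), ← mul_assoc, mul_inv_cancel_comm]
    · simp
  · intro c _ hc
    simp [hc]
  · simp

/-- The bijection `A × B → T`. -/
def Polarization.equiv (S : Polarization P) : S.A × S.B ≃ P.T :=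
  Equiv.ofBijective (fun x => (x.1 : P.T) * (x.2 : P.T)) S.complement

theorem Polarization.equiv_apply (S : Polarization P) (x : S.A × S.B) :
    S.equiv x = (x.1 : P.T) * (x.2 : P.T) := rfl

theorem Polarization.equiv_mul (S : Polarization P) (x y : S.A × S.B) :
    S.equiv (x * y) = S.equiv x * S.equiv y := by
  simp [S.equiv_apply, mul_mul_mul_comm]

/-- Dedekind independence: distinct characters of `B` are linearly independent in the
`|B|`-dimensional space of functions on `B`. -/
theorem card_le_of_pairing {A B : Type*} [Monoid A] [Monoid B] [Finite B] (f : A →* B →* Fˣ)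
    (hf : Function.Injective f) : Nat.card A ≤ Nat.card B := by
  have := Fintype.ofFinite B
  have h : LinearIndependent F (fun (a : A) (b : B) => ((f a b : Fˣ) : F)) := by
    refine (linearIndependent_monoidHom B F).comp (fun a => (Units.coeHom F).comp (f a)) ?_
    intro a a' haa'
    apply hf
    ext b
    exact DFunLike.congr_fun haa' b
  have : Finite A := h.finite
  have := Fintype.ofFinite A
  rw [Nat.card_eq_fintype_card, Nat.card_eq_fintype_card]
  simpa using h.fintype_card_le_finrank

/-- The pairing of two subgroups of `T` given by `β`. -/
def DivisionDatum.pairing (P : DivisionDatum F H) (A B : Subgroup P.T) : A →* B →* Fˣ :=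
  (MonoidHom.compHom' B.subtype).comp (P.β.comp A.subtype)

/-- An element of `A` orthogonal to `B` is also orthogonal to the isotropic `A`, hence to all of
`T`. -/
theorem Polarization.pairing_injective (S : Polarization P) :
    Function.Injective (P.pairing S.A S.B) := by
  rw [injective_iff_map_eq_one]
  intro a ha
  have : (a : P.T) = 1 := by
    apply P.nondegenerate
    intro s
    obtain ⟨x, rfl⟩ := S.equiv.surjective s
    rw [S.equiv_apply, map_mul, S.trivial_A _ a.2 _ x.1.2, one_mul]
    exact DFunLike.congr_fun ha x.2
  exact Subtype.ext this

/-- The same decomposition with the two factors exchanged. -/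
def Polarization.symm (S : Polarization P) : Polarization P where
  A := S.B
  B := S.A
  complement := S.complement.symm
  trivial_A := S.trivial_B
  trivial_B := S.trivial_A

theorem Polarization.card_eq (S : Polarization P) : Nat.card S.A = Nat.card S.B := by
  have := P.finite
  exact le_antisymm (card_le_of_pairing _ S.pairing_injective)
    (card_le_of_pairing _ S.symm.pairing_injective)

theorem Polarization.card_T (S : Polarization P) : Nat.card P.T = Nat.card S.B ^ 2 := by
  rw [← Nat.card_congr S.equiv, Nat.card_prod, S.card_eq, sq]

/-- The entry at `(i, b⁻¹ i)` of a linear combination sees only the matrices `X_{ab}` with this `b`,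
with values `β(a, i)`. This reduces the claim to independence of the characters `β(a, ·)` of `B`. -/
theorem linearIndependent_standardX (S : Polarization P) :
    LinearIndependent F (fun x : S.A × S.B => standardX S x.1 x.2) := by
  have := P.finite
  have := Fintype.ofFinite S.A
  have hχ : LinearIndependent F (fun (a : S.A) (b : S.B) => ((P.β a b : Fˣ) : F)) := by
    refine (linearIndependent_monoidHom S.B F).comp
      (fun a => (Units.coeHom F).comp (P.pairing S.A S.B a)) ?_
    intro a a' haa'
    apply S.pairing_injective
    ext b
    exact DFunLike.congr_fun haa' b
  rw [Fintype.linearIndependent_iff] at hχ ⊢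
  intro c hc
  rintro ⟨a, b⟩
  refine hχ (fun a => c (a, b)) ?_ a
  ext i
  have h := congrFun (congrFun hc i) (b⁻¹ * i)
  rw [Matrix.sum_apply, Fintype.sum_prod_type] at h
  rw [Finset.sum_apply]
  refine Eq.trans ?_ h
  refine Finset.sum_congr rfl fun a' _ => ?_
  simp only [Matrix.smul_apply, standardX_apply, Pi.smul_apply]
  rw [Finset.sum_eq_single b]
  · simp
  · intro b' _ hb'
    rw [if_neg, smul_zero]
    intro h
    apply hb'
    rw [← mul_assoc, right_eq_mul, mul_inv_eq_one] at h
    exact h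
  · simp

/-- The matrices `X_{ab}` form a basis. -/
def standardBasis (S : Polarization P) : Module.Basis (S.A × S.B) F (Matrix S.B S.B F) :=
  haveI := P.finite
  haveI := Fintype.ofFinite S.A
  basisOfLinearIndependentOfCardEqFinrank (linearIndependent_standardX S) (by
    rw [Module.finrank_matrix, Module.finrank_self, mul_one, Fintype.card_prod,
      ← Nat.card_eq_fintype_card, ← Nat.card_eq_fintype_card, S.card_eq])

theorem standardBasis_apply (S : Polarization P) (x : S.A × S.B) :
    standardBasis S x = standardX S x.1 x.2 := by
  simp [standardBasis]

theorem standardX_one (S : Polarization P) : standardX S 1 1 = 1 := by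
  ext i j
  simp [standardX_apply, Matrix.one_apply]

theorem isUnit_standardX (S : Polarization P) (a : S.A) (b : S.B) : IsUnit (standardX S a b) := by
  have h1 : standardX S a b * standardX S a⁻¹ b⁻¹ = ((P.β (b : P.T) (a : P.T) : Fˣ)⁻¹ : F) • 1 := by
    rw [standardX_mul]
    simp [standardX_one]
  have h2 : IsUnit (standardX S a b * standardX S a⁻¹ b⁻¹) := by
    rw [h1, ← Algebra.algebraMap_eq_smul_one]
    exact (isUnit_iff_ne_zero.2 (by simp)).map (algebraMap F _)
  rw [Matrix.isUnit_iff_isUnit_det, Matrix.det_mul] at h2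
  exact (Matrix.isUnit_iff_isUnit_det _).2 (isUnit_of_mul_isUnit_left h2)

/-- The grading of the standard realization. -/
def standardGrading (S : Polarization P) (h : H) : Submodule F (Matrix S.B S.B F) :=
  Submodule.span F (standardBasis S '' {x | (S.equiv x : H) = h})

/-- The standard realization. -/
def standardRealization (S : Polarization P) : Realization P (standardGrading S) where
  X := (standardBasis S).reindex S.equiv
  isUnit t := by
    rw [Module.Basis.reindex_apply, standardBasis_apply]
    exact isUnit_standardX S _ _
  mul s t := by
    obtain ⟨x, rfl⟩ := S.equiv.surjective s
    obtain ⟨y, rfl⟩ := S.equiv.surjective t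
    rw [← S.equiv_mul]
    simp only [Module.Basis.reindex_apply, Equiv.symm_apply_apply, standardBasis_apply]
    exact ⟨_, standardX_mul S _ _ _ _⟩
  comm s t := by
    obtain ⟨x, rfl⟩ := S.equiv.surjective s
    obtain ⟨y, rfl⟩ := S.equiv.surjective t
    simp only [Module.Basis.reindex_apply, Equiv.symm_apply_apply, standardBasis_apply]
    rw [standardX_mul, standardX_mul, mul_comm y.1, mul_comm y.2, smul_smul]
    congr 1
    rw [← Units.val_mul]
    congr 1
    simp only [S.equiv_apply, map_mul, MonoidHom.mul_apply]
    rw [S.trivial_A _ x.1.2 _ y.1.2, S.trivial_B _ x.2.2 _ y.2.2,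
      P.beta_swap (x.1 : P.T) (y.2 : P.T)]
    simp
  span h := by
    rw [standardGrading]
    congr 1
    ext M
    constructor
    · rintro ⟨x, hx, rfl⟩
      exact ⟨S.equiv x, hx, by simp⟩
    · rintro ⟨t, ht, rfl⟩
      exact ⟨S.equiv.symm t, by simpa using ht, by simp⟩

theorem exists_algEquiv_of_structure_constants {ι : Type*} {D E : Type*} [Ring D] [Algebra F D]
    [Ring E] [Algebra F E] (Y : Module.Basis ι F D) (Z : Module.Basis ι F E) (m : ι → ι → ι)
    (c : ι → ι → F) (hY : ∀ i j, Y i * Y j = c i j • Y (m i j))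
    (hZ : ∀ i j, Z i * Z j = c i j • Z (m i j)) : ∃ ψ : D ≃ₐ[F] E, ∀ i, ψ (Y i) = Z i := by
  let l : D ≃ₗ[F] E := Y.equiv Z (Equiv.refl ι)
  have hl : ∀ i, l (Y i) = Z i := by simp [l]
  have hmul : ∀ x y, l (x * y) = l x * l y := by
    have : (LinearMap.mul F D).compr₂ l.toLinearMap =
        (LinearMap.mul F E).compl₁₂ l.toLinearMap l.toLinearMap := by
      refine Y.ext fun i => Y.ext fun j => ?_
      simp [hY, hZ, hl]
    exact fun x y => LinearMap.congr_fun₂ this x y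
  have hone : l 1 = 1 := by
    obtain ⟨x, hx⟩ := l.surjective 1
    rw [← mul_one (l 1), ← hx, ← hmul, one_mul]
  exact ⟨AlgEquiv.ofLinearEquiv l hone hmul, hl⟩

/-- Every realization of `(T, β)` is isomorphic to the standard one. -/
theorem Realization.exists_algEquiv_standard [IsAlgClosed F] {D : Type*} [Ring D] [Algebra F D]
    {𝒟 : H → Submodule F D} (R : Realization P 𝒟) (S : Polarization P) :
    ∃ ψ : D ≃ₐ[F] Matrix S.B S.B F, ∀ h, (𝒟 h).map ψ.toLinearMap = standardGrading S h := by
  have := R.finiteDimensional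
  have := R.isGradedDivision.nontrivial
  -- Isotropy makes the generators commute within `A` and within `B`, so both families can be
  -- rescaled to be multiplicative.
  obtain ⟨α, hα⟩ := exists_rescaling_multiplicative (F := F) (fun a : S.A => R.X a)
    (fun a => R.isUnit a) (fun a b => R.mul a b) (fun a b => by
      rw [R.comm, S.trivial_A _ a.2 _ b.2, Units.val_one, one_smul])
  obtain ⟨δ, hδ⟩ := exists_rescaling_multiplicative (F := F) (fun a : S.B => R.X a)
    (fun a => R.isUnit a) (fun a b => R.mul a b) (fun a b => by
      rw [R.comm, S.trivial_B _ a.2 _ b.2, Units.val_one, one_smul])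
  have hw : ∀ x : S.A × S.B, ∃ w : Fˣ,
      (α x.1 • R.X x.1) * (δ x.2 • R.X x.2) = w • R.X (S.equiv x) := by
    intro x
    obtain ⟨c, hc⟩ := R.mul x.1 x.2
    have hc0 : c ≠ 0 := by
      rintro rfl
      have := (R.isUnit x.1).mul (R.isUnit x.2)
      rw [hc, zero_smul] at this
      exact not_isUnit_zero this
    refine ⟨α x.1 * δ x.2 * Units.mk0 c hc0, ?_⟩
    rw [smul_mul_smul_comm, hc, S.equiv_apply, mul_smul _ (Units.mk0 c hc0)]
    rfl
  choose w hw using hw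
  let Y : Module.Basis (S.A × S.B) F D := (R.X.reindex S.equiv.symm).unitsSMul w
  have hY : ∀ x, Y x = w x • R.X (S.equiv x) := by
    intro x
    simp [Y, Module.Basis.unitsSMul_apply]
  -- In a product of two basis elements only the inner factors need to be exchanged, costing `β(b,
  -- a')`; this is the constant of `standardX_mul`.
  obtain ⟨ψ, hψ⟩ := exists_algEquiv_of_structure_constants Y (standardBasis S) (fun x y => x * y)
    (fun x y => ((P.β (x.2 : P.T) (y.1 : P.T) : Fˣ) : F)) (by
      intro x y
      rw [hY, hY, hY, ← hw, ← hw, ← hw, Prod.fst_mul, Prod.snd_mul, ← hα, ← hδ]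
      have : (δ x.2 • R.X x.2) * (α y.1 • R.X y.1) =
          ((P.β (x.2 : P.T) (y.1 : P.T) : Fˣ) : F) • ((α y.1 • R.X y.1) * (δ x.2 • R.X x.2)) := by
        rw [smul_mul_smul_comm, smul_mul_smul_comm, R.comm, mul_comm, smul_comm]
      rw [mul_assoc, ← mul_assoc (δ x.2 • R.X x.2), this]
      simp only [smul_mul_assoc, mul_smul_comm, mul_assoc, smul_comm (δ y.2)]) (by
      intro x y
      simp only [standardBasis_apply]
      exact standardX_mul S _ _ _ _)
  refine ⟨ψ, fun h => ?_⟩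
  by_cases hh : h ∈ P.T
  · lift h to P.T using hh
    obtain ⟨x, rfl⟩ := S.equiv.surjective h
    rw [R.component_eq, (standardRealization S).component_eq, Submodule.map_span,
      Set.image_singleton]
    have h1 : R.X (S.equiv x) = (w x)⁻¹ • Y x := by rw [hY, inv_smul_smul]
    have h2 : ψ.toLinearMap (R.X (S.equiv x)) =
        (w x)⁻¹ • (standardRealization S).X (S.equiv x) := by
      rw [h1, AlgEquiv.toLinearMap_apply, Units.smul_def, map_smul, hψ]
      simp [standardRealization, Units.smul_def]
    rw [h2]
    exact Submodule.span_singleton_group_smul_eq F (w x)⁻¹ _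
  · rw [R.component_eq_bot hh, (standardRealization S).component_eq_bot hh, Submodule.map_bot]

end Standard

theorem AlgEquiv.apply_mem_map_iff {F A B : Type*} [CommSemiring F] [Semiring A] [Algebra F A]
    [Semiring B] [Algebra F B] (φ : A ≃ₐ[F] B) (p : Submodule F A) (x : A) :
    φ x ∈ p.map φ.toLinearMap ↔ x ∈ p :=
  Function.Injective.mem_set_image φ.injective

/-! ### Endomorphism algebras as matrix algebras. -/

section EndMatrix

variable (F : Type*) [Field F] {D : Type*} [Ring D] [Algebra F D] {U : Type*} [AddCommGroup U]
  [Module F U] [Module Dᵐᵒᵖ U] [IsScalarTower F Dᵐᵒᵖ U] {k : Type*} [Fintype k] [DecidableEq k]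

/-- Endomorphisms of a free right module as matrices over the ring of scalars. -/
def endMatrixEquiv (u : Module.Basis k Dᵐᵒᵖ U) : Module.End Dᵐᵒᵖ U ≃ₐ[F] Matrix k k D where
  toFun f := Matrix.of fun i j => (u.repr (f (u j)) i).unop
  -- `ℕ` commutes with every scalar action, whereas `Dᵐᵒᵖ` need not be commutative.
  invFun M := u.constr ℕ fun j => ∑ i, MulOpposite.op (M i j) • u i
  left_inv f := by
    refine u.ext fun j => ?_
    simp [u.sum_repr]
  right_inv M := by
    ext i j
    change (u.repr (u.constr ℕ (fun j => ∑ i, MulOpposite.op (M i j) • u i) (u j)) i).unop = M i j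
    rw [Module.Basis.constr_basis, u.repr_sum_self, MulOpposite.unop_op]
  map_mul' f g := by
    ext i j
    simp only [Matrix.of_apply, Matrix.mul_apply, Module.End.mul_apply]
    conv_lhs => rw [← u.sum_repr (g (u j)), map_sum, map_sum, Finsupp.finsetSum_apply]
    simp only [map_smul, Finsupp.smul_apply, smul_eq_mul, MulOpposite.unop_mul,
      Finset.unop_sum]
  map_add' f g := by
    ext i j
    simp
  commutes' c := by
    ext i j
    rw [Matrix.of_apply, Matrix.algebraMap_matrix_apply, Module.algebraMap_end_apply]
    rw [← one_smul Dᵐᵒᵖ (u j), ← smul_assoc, map_smul, u.repr_self]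
    rcases eq_or_ne i j with rfl | h
    · simp [Algebra.algebraMap_eq_smul_one]
    · simp [h]

theorem endMatrixEquiv_apply (u : Module.Basis k Dᵐᵒᵖ U) (f : Module.End Dᵐᵒᵖ U) (i j : k) :
    endMatrixEquiv F u f i j = (u.repr (f (u j)) i).unop := rfl

end EndMatrix

section MatrixGrading

variable {F : Type*} [Field F] {H : Type*} [CommGroup H] {P : DivisionDatum F H}

/-- This replaces the spanning set by an entrywise condition of the same shape as
`mem_endComponent_iff`, so the two gradings can be compared block by block. -/
theorem mem_matrixGrading_iff (S : Polarization P) {k : ℕ} (γ : Fin k → H) (h : H)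
    (M : Matrix (Fin k) (Fin k) (Matrix S.B S.B F)) :
    Matrix.compAlgEquiv (Fin k) S.B F F M ∈ matrixGrading S γ h ↔
      ∀ i j, M i j ∈ standardGrading S ((γ i)⁻¹ * (h * γ j)) := by
  constructor
  · intro hM
    obtain ⟨N, hN⟩ : ∃ N, N = Matrix.compAlgEquiv (Fin k) S.B F F M := ⟨_, rfl⟩
    rw [← hN] at hM
    obtain rfl : M = (Matrix.compAlgEquiv (Fin k) S.B F F).symm N := by rw [hN]; simp
    clear hN
    induction hM using Submodule.span_induction with
    | mem N hN =>
      obtain ⟨i', j', a, b, rfl, rfl⟩ := hN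
      intro i j
      by_cases hij : i' = i ∧ j' = j
      · obtain ⟨rfl, rfl⟩ := hij
        refine Submodule.subset_span ⟨(a, b), ?_, ?_⟩
        · rw [Set.mem_ofPred_eq, S.equiv_apply]
          group
        · rw [standardBasis_apply]
          ext x y
          change _ = ((Matrix.single i' j' (1 : F)) ⊗ₖ (standardX S a b)) (i', x) (j', y)
          simp [Matrix.kroneckerMap_apply]
      · convert (standardGrading S ((γ i)⁻¹ * (_ * γ j))).zero_mem
        ext x y
        change ((Matrix.single i' j' (1 : F)) ⊗ₖ (standardX S a b)) (i, x) (j, y) = 0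
        simp [Matrix.kroneckerMap_apply, hij]
    | zero => intro i j; rw [map_zero]; exact zero_mem _
    | add x y _ _ hx hy => intro i j; rw [map_add]; exact add_mem (hx i j) (hy i j)
    | smul c x _ hx => intro i j; rw [map_smul]; exact Submodule.smul_mem _ _ (hx i j)
  · intro hM
    rw [Matrix.matrix_eq_sum_single M, map_sum]
    refine sum_mem fun i _ => ?_
    rw [map_sum]
    refine sum_mem fun j _ => ?_
    have key : ∀ N ∈ standardGrading S ((γ i)⁻¹ * (h * γ j)),
        Matrix.compAlgEquiv (Fin k) S.B F F (Matrix.single i j N) ∈ matrixGrading S γ h := by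
      intro N hN
      induction hN using Submodule.span_induction with
      | mem N hN =>
        obtain ⟨⟨a, b⟩, hab, rfl⟩ := hN
        refine Submodule.subset_span ⟨i, j, a, b, ?_, ?_⟩
        · rw [Set.mem_ofPred_eq, S.equiv_apply] at hab
          rw [hab]
          group
        · rw [standardBasis_apply]
          ext ⟨i', x⟩ ⟨j', y⟩
          change Matrix.single i j (standardX S a b) i' j' x y = _
          rw [Matrix.kroneckerMap_apply, Matrix.single_apply, Matrix.single_apply]
          split_ifs <;> simp
      | zero => rw [Matrix.single_zero, map_zero]; exact zero_mem _
      | add x y _ _ hx hy => rw [Matrix.single_add, map_add]; exact add_mem hx hy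
      | smul c x _ hx => rw [← Matrix.smul_single, map_smul]; exact Submodule.smul_mem _ _ hx
    exact key _ (hM i j)

/-- The algebra of endomorphisms of a graded right module with a homogeneous basis of degrees `γ`
over a realization of `(T, β)` is the matrix algebra with the grading determined by
`(T, β, γ)`. -/
theorem exists_end_algEquiv_matrix [IsAlgClosed F] {D : Type*} [Ring D] [Algebra F D]
    {𝒟 : H → Submodule F D} (R : Realization P 𝒟) (S : Polarization P)
    {U : Type*} [AddCommGroup U] [Module F U] [Module Dᵐᵒᵖ U] [IsScalarTower F Dᵐᵒᵖ U]
    {𝒰 : H → Submodule F U} (h𝒰 : IsGradedRightModule 𝒟 𝒰) {k : ℕ} {γ : Fin k → H}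
    (u : Module.Basis (Fin k) Dᵐᵒᵖ U) (hu : ∀ i, u i ∈ 𝒰 (γ i)) :
    ∃ Φ : Module.End Dᵐᵒᵖ U ≃ₐ[F] Matrix (Fin k × S.B) (Fin k × S.B) F,
      ∀ h, (endComponent 𝒰 h).map Φ.toLinearMap = matrixGrading S γ h := by
  obtain ⟨ψ, hψ⟩ := R.exists_algEquiv_standard S
  refine ⟨((endMatrixEquiv F u).trans ψ.mapMatrix).trans (Matrix.compAlgEquiv _ _ _ _),
    fun h => ?_⟩
  ext M
  obtain ⟨M, rfl⟩ := (((endMatrixEquiv F u).trans ψ.mapMatrix).trans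
    (Matrix.compAlgEquiv _ _ _ _)).surjective M
  rw [AlgEquiv.apply_mem_map_iff, AlgEquiv.trans_apply, mem_matrixGrading_iff,
    mem_endComponent_iff R.isGradedDivision.grading h𝒰 hu]
  refine forall₂_congr fun i j => ?_
  rw [← hψ, AlgEquiv.trans_apply, AlgEquiv.mapMatrix_apply, Matrix.map_apply,
    AlgEquiv.apply_mem_map_iff, endMatrixEquiv_apply]

end MatrixGrading

/-! ### Isotropic decompositions of groups with a nondegenerate alternating bicharacter. -/

section Symplectic

variable {F : Type*} [Field F] {H : Type*} [CommGroup H] (P : DivisionDatum F H)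

/-- Take `a` of order the exponent of `K`. The image of `β(a, ·)` is a finite, hence cyclic,
subgroup of `Fˣ`; let `β(a, b)` generate it. Nondegeneracy gives this generator the order of `a`, so
it is a primitive root of unity, and the values `β(b, x)`, being roots of unity of the same
exponent, are its powers. -/
theorem DivisionDatum.exists_hyperbolic_pair (K : Subgroup P.T)
    (hK : ∀ t ∈ K, (∀ s ∈ K, P.β t s = 1) → t = 1) :
    ∃ a ∈ K, ∃ b ∈ K, orderOf (P.β a b) = Monoid.exponent K ∧
      (∀ x ∈ K, P.β a x ∈ Subgroup.zpowers (P.β a b)) ∧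
      ∀ x ∈ K, P.β b x ∈ Subgroup.zpowers (P.β a b) := by
  have := P.finite
  obtain ⟨⟨a, haK⟩, ha⟩ :=
    Monoid.exists_orderOf_eq_exponent (Monoid.ExponentExists.of_finite (G := K))
  rw [Subgroup.orderOf_mk] at ha
  have hexp : ∀ x ∈ K, x ^ Monoid.exponent K = 1 := fun x hx =>
    congrArg Subtype.val (Monoid.pow_exponent_eq_one (⟨x, hx⟩ : K))
  let f : K →* Fˣ := (P.β a).comp K.subtype
  have : Finite f.range := Finite.of_surjective f.rangeRestrict f.rangeRestrict_surjective
  obtain ⟨⟨_, ⟨⟨b, hbK⟩, rfl⟩⟩, hb⟩ := IsCyclic.exists_generator (α := f.range)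
  have hgen : ∀ x ∈ K, P.β a x ∈ Subgroup.zpowers (P.β a b) := by
    intro x hx
    obtain ⟨i, hi⟩ := hb ⟨f ⟨x, hx⟩, ⟨_, rfl⟩⟩
    exact ⟨i, congrArg Subtype.val hi⟩
  have hord : orderOf (P.β a b) = Monoid.exponent K := by
    rw [← ha]
    apply Nat.dvd_antisymm
    · apply orderOf_dvd_of_pow_eq_one
      rw [← MonoidHom.pow_apply, ← map_pow, pow_orderOf_eq_one, map_one, MonoidHom.one_apply]
    · apply orderOf_dvd_of_pow_eq_one
      apply hK _ (K.pow_mem haK _)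
      intro s hs
      obtain ⟨i, hi⟩ := hgen s hs
      rw [map_pow, MonoidHom.pow_apply, ← hi]
      change (P.β a b ^ i) ^ _ = 1
      rw [← zpow_natCast, zpow_comm, zpow_natCast, pow_orderOf_eq_one, one_zpow]
  have hpos : 0 < Monoid.exponent K := Monoid.exponent_ne_zero_of_finite.bot_lt
  refine ⟨a, haK, b, hbK, hord, hgen, fun x hx => ?_⟩
  have : NeZero (Monoid.exponent K) := ⟨hpos.ne'⟩
  have hprim : IsPrimitiveRoot (P.β a b) (Monoid.exponent K) := hord ▸ IsPrimitiveRoot.orderOf _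
  rw [hprim.zpowers_eq, mem_rootsOfUnity, ← MonoidHom.pow_apply, ← map_pow, hexp b hbK, map_one,
    MonoidHom.one_apply]

/-- Induction on the order: the orthogonal complement `K'` of a hyperbolic pair `a, b` in `K` is
again nondegenerate and `K = K'⟨a⟩⟨b⟩`. Decompose `K'`, then adjoin `a` to one factor and `b` to the
other. -/
theorem DivisionDatum.exists_isotropic_decomposition (n : ℕ) : ∀ K : Subgroup P.T, Nat.card K ≤ n →
    (∀ t ∈ K, (∀ s ∈ K, P.β t s = 1) → t = 1) →
    ∃ A B : Subgroup P.T, A ⊔ B = K ∧ Disjoint A B ∧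
      (∀ a ∈ A, ∀ a' ∈ A, P.β a a' = 1) ∧ ∀ b ∈ B, ∀ b' ∈ B, P.β b b' = 1 := by
  have := P.finite
  induction n with
  | zero => intro K hK; exact absurd hK (by simp [Nat.card_pos.ne'])
  | succ n ih =>
    intro K hcard hK
    by_cases hbot : K = ⊥
    · refine ⟨⊥, ⊥, by simp [hbot], disjoint_bot_left, ?_, ?_⟩ <;> simp
    obtain ⟨a, haK, b, hbK, hord, hgena, hgenb⟩ := P.exists_hyperbolic_pair K hK
    have hexp : ∀ x ∈ K, x ^ orderOf (P.β a b) = 1 := fun x hx => by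
      rw [hord]
      exact congrArg Subtype.val (Monoid.pow_exponent_eq_one (⟨x, hx⟩ : K))
    have hne : P.β a b ≠ 1 := by
      intro h1
      rw [h1, orderOf_one] at hexp
      exact hbot ((Subgroup.eq_bot_iff_forall K).2 fun x hx => by simpa using hexp x hx)
    let K' : Subgroup P.T := K ⊓ ((P.β a).ker ⊓ (P.β b).ker)
    have hK'K : K' ≤ K := inf_le_left
    have hK'a : ∀ x ∈ K', P.β a x = 1 := fun x hx => hx.2.1
    have hK'b : ∀ x ∈ K', P.β b x = 1 := fun x hx => hx.2.2
    have hdecomp : ∀ x ∈ K, ∃ y ∈ K', ∃ i j : ℤ, x = y * a ^ i * b ^ j := by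
      intro x hx
      obtain ⟨j, hj⟩ := hgena x hx
      obtain ⟨i, hi⟩ := hgenb x hx
      -- Here `β(a, x) = β(a, b)^j` and `β(b, x) = β(a, b)^i`; the corrections cancel these values
      -- since `β(b, a)` is the inverse of `β(a, b)`.
      refine ⟨x * a ^ i * b ^ (-j), ⟨?_, ?_, ?_⟩, -i, j, ?_⟩
      · exact K.mul_mem (K.mul_mem hx (K.zpow_mem haK _)) (K.zpow_mem hbK _)
      · change P.β a (x * a ^ i * b ^ (-j)) = 1
        rw [map_mul, map_mul, map_zpow, map_zpow, P.alternating, ← hj]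
        simp
      · change P.β b (x * a ^ i * b ^ (-j)) = 1
        rw [map_mul, map_mul, map_zpow, map_zpow, P.alternating, ← hi, P.beta_swap b a]
        simp
      · rw [zpow_neg, zpow_neg, mul_right_comm, inv_mul_cancel_right, mul_inv_cancel_right]
    have hK' : ∀ t ∈ K', (∀ s ∈ K', P.β t s = 1) → t = 1 := by
      intro t ht hts
      apply hK t (hK'K ht)
      intro s hs
      obtain ⟨y, hy, i, j, rfl⟩ := hdecomp s hs
      rw [map_mul, map_mul, map_zpow, map_zpow, hts y hy, P.beta_swap t a, P.beta_swap t b,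
        hK'a t ht, hK'b t ht]
      simp
    have hlt : Nat.card K' < Nat.card K := by
      apply lt_of_le_of_ne (Subgroup.card_le_of_le hK'K)
      intro he
      have := Subgroup.eq_of_le_of_card_ge hK'K he.ge
      have haK' : a ∈ K' := this ▸ haK
      have := hK'b a haK'
      rw [P.beta_swap, inv_eq_one] at this
      exact hne this
    obtain ⟨A, B, hAB, hdisj, hA, hB⟩ := ih K' (by omega) hK'
    have hAK' : A ≤ K' := hAB ▸ le_sup_left
    have hBK' : B ≤ K' := hAB ▸ le_sup_right
    have hiso : ∀ (C : Subgroup P.T) (c : P.T), (∀ x ∈ C, ∀ y ∈ C, P.β x y = 1) →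
        (∀ x ∈ C, P.β c x = 1) → ∀ x ∈ C ⊔ Subgroup.zpowers c, ∀ y ∈ C ⊔ Subgroup.zpowers c,
          P.β x y = 1 := by
      intro C c hC hc x hx y hy
      obtain ⟨x, hxC, _, ⟨i, rfl⟩, rfl⟩ := Subgroup.mem_sup.1 hx
      obtain ⟨y, hyC, _, ⟨j, rfl⟩, rfl⟩ := Subgroup.mem_sup.1 hy
      simp only [map_mul, map_zpow, MonoidHom.mul_apply, MonoidHom.zpow_apply]
      rw [hC x hxC y hyC, hc y hyC, P.beta_swap x c, hc x hxC, P.alternating]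
      simp
    refine ⟨A ⊔ Subgroup.zpowers a, B ⊔ Subgroup.zpowers b, ?_, ?_,
      hiso A a hA fun x hx => hK'a x (hAK' hx), hiso B b hB fun x hx => hK'b x (hBK' hx)⟩
    · rw [sup_sup_sup_comm, hAB]
      apply le_antisymm
      · simp [hK'K, haK, hbK]
      · intro x hx
        obtain ⟨y, hy, i, j, rfl⟩ := hdecomp x hx
        rw [mul_assoc]
        exact Subgroup.mul_mem_sup hy (Subgroup.mul_mem_sup ⟨i, rfl⟩ ⟨j, rfl⟩)
    · rw [Subgroup.disjoint_def]
      intro x hx hx'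
      obtain ⟨y, hy, _, ⟨i, rfl⟩, hxy⟩ := Subgroup.mem_sup.1 hx
      obtain ⟨z, hz, _, ⟨j, rfl⟩, hxz⟩ := Subgroup.mem_sup.1 hx'
      simp only at hxy hxz
      have h1 : P.β a x = 1 := by
        rw [← hxy, map_mul, map_zpow, hK'a y (hAK' hy), P.alternating]
        simp
      have h2 : P.β b x = 1 := by
        rw [← hxz, map_mul, map_zpow, hK'b z (hBK' hz), P.alternating]
        simp
      -- Pairing with `b` leaves only a power of `β(a, b)`, whose order is the exponent of `K`; a
      -- trivial value therefore makes `a ^ i` trivial.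
      have h3 : a ^ i = 1 := by
        rw [← hxy, map_mul, map_zpow, hK'b y (hAK' hy), one_mul, P.beta_swap, inv_zpow,
          inv_eq_one] at h2
        obtain ⟨l, rfl⟩ := orderOf_dvd_iff_zpow_eq_one.2 h2
        rw [zpow_mul, zpow_natCast, hexp a haK, one_zpow]
      have h4 : b ^ j = 1 := by
        rw [← hxz, map_mul, map_zpow, hK'a z (hBK' hz), one_mul] at h1
        obtain ⟨l, rfl⟩ := orderOf_dvd_iff_zpow_eq_one.2 h1
        rw [zpow_mul, zpow_natCast, hexp b hbK, one_zpow]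
      rw [h3, mul_one] at hxy
      rw [h4, mul_one] at hxz
      subst hxy
      subst hxz
      exact Subgroup.disjoint_def.1 hdisj hy hz

theorem DivisionDatum.nonempty_polarization : Nonempty (Polarization P) := by
  obtain ⟨A, B, hAB, hdisj, hA, hB⟩ := P.exists_isotropic_decomposition _ ⊤ le_rfl
    (fun t _ h => P.nondegenerate t fun s => h s trivial)
  refine ⟨⟨A, B, ?_, hA, hB⟩⟩
  apply Subgroup.isComplement'_of_disjoint_and_mul_eq_univ hdisj
  rw [← Subgroup.mul_normal, hAB]
  rfl

end Symplectic

/-! ### Rank-one endomorphisms and homogeneous functionals. -/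

section RankOne

variable {F : Type*} [Field F] {H : Type*} [CommGroup H] {D : Type*} [Ring D] [Algebra F D]
  {𝒟 : H → Submodule F D} {U : Type*} [AddCommGroup U] [Module F U] [Module Dᵐᵒᵖ U]
  {𝒰 : H → Submodule F U}

theorem comp_smulRight (f : Module.End Dᵐᵒᵖ U) (l : U →ₗ[Dᵐᵒᵖ] Dᵐᵒᵖ) (x : U) :
    f * l.smulRight x = l.smulRight (f x) := by
  ext y
  simp

theorem smulRight_mem_endComponent [IsScalarTower F Dᵐᵒᵖ U]
    (h𝒰 : IsGradedRightModule 𝒟 𝒰) {l : U →ₗ[Dᵐᵒᵖ] Dᵐᵒᵖ} {g : H}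
    (hl : ∀ h, ∀ y ∈ 𝒰 h, (l y).unop ∈ 𝒟 (g⁻¹ * h)) {h : H} {x : U} (hx : x ∈ 𝒰 h) :
    l.smulRight x ∈ endComponent 𝒰 (h * g⁻¹) := by
  intro k y hy
  rw [LinearMap.smulRight_apply, mul_assoc]
  exact h𝒰.smul_mem _ _ _ _ hx (hl k y hy)

/-- A nonzero homogeneous element of a graded free module admits a homogeneous functional with
value one. -/
theorem IsGradedRightModule.exists_functional (h𝒟 : IsGradedDivision 𝒟)
    (h𝒰 : IsGradedRightModule 𝒟 𝒰) {k : Type*} [Fintype k] {γ : k → H}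
    (u : Module.Basis k Dᵐᵒᵖ U) (hu : ∀ i, u i ∈ 𝒰 (γ i)) {g : H} {v : U} (hv : v ∈ 𝒰 g)
    (hv0 : v ≠ 0) : ∃ l : U →ₗ[Dᵐᵒᵖ] Dᵐᵒᵖ, l v = 1 ∧
      ∀ h, ∀ y ∈ 𝒰 h, (l y).unop ∈ 𝒟 (g⁻¹ * h) := by
  obtain ⟨i, hi⟩ : ∃ i, u.repr v i ≠ 0 := by
    by_contra! hcon
    exact hv0 (u.repr.map_eq_zero_iff.1 (Finsupp.ext hcon))
  have hmem : ∀ h, ∀ y ∈ 𝒰 h, (u.repr y i).unop ∈ 𝒟 ((γ i)⁻¹ * h) := fun h y hy =>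
    (h𝒰.mem_iff_repr_mem h𝒟.grading hu).1 hy i
  obtain ⟨c, hc, -, hci⟩ := h𝒟.exists_inverse (hmem g v hv)
    (fun h0 => hi (MulOpposite.unop_injective h0))
  -- A coordinate that does not vanish on `v`, normalized by the homogeneous inverse of its value
  -- there.
  refine ⟨(u.coord i).smulRight (MulOpposite.op c), ?_, fun h y hy => ?_⟩
  · rw [LinearMap.smulRight_apply, smul_eq_mul, Module.Basis.coord_apply]
    exact MulOpposite.unop_injective hci
  · have := h𝒟.grading.mul_mem _ _ _ _ hc (hmem h y hy)
    rw [mul_inv, inv_inv, mul_mul_mul_comm, mul_inv_cancel, one_mul] at this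
    simpa [LinearMap.smulRight_apply] using this

end RankOne

/-! ### Recovering the module and the bicharacter from the graded endomorphism algebra. -/

section Uniqueness

variable {F : Type*} [Field F] {H : Type*} [CommGroup H]

/-- An isomorphism between the graded endomorphism algebras of two graded modules over graded
division algebras comes from an isomorphism of the modules up to a shift of degrees. -/
theorem exists_shift_of_end_algEquiv {P P' : DivisionDatum F H}
    {D : Type*} [Ring D] [Algebra F D] {𝒟 : H → Submodule F D} (R : Realization P 𝒟)
    {U : Type*} [AddCommGroup U] [Module F U] [Module Dᵐᵒᵖ U] [IsScalarTower F Dᵐᵒᵖ U]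
    {𝒰 : H → Submodule F U} (h𝒰 : IsGradedRightModule 𝒟 𝒰)
    {k : Type*} [Fintype k] [Nonempty k] {γ : k → H} (u : Module.Basis k Dᵐᵒᵖ U)
    (hu : ∀ i, u i ∈ 𝒰 (γ i))
    {D' : Type*} [Ring D'] [Algebra F D'] {𝒟' : H → Submodule F D'} (R' : Realization P' 𝒟')
    {U' : Type*} [AddCommGroup U'] [Module F U'] [Module D'ᵐᵒᵖ U'] [IsScalarTower F D'ᵐᵒᵖ U']
    {𝒰' : H → Submodule F U'} (h𝒰' : IsGradedRightModule 𝒟' 𝒰')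
    {k' : Type*} [Fintype k'] {γ' : k' → H} (u' : Module.Basis k' D'ᵐᵒᵖ U')
    (hu' : ∀ i, u' i ∈ 𝒰' (γ' i))
    (Φ : Module.End Dᵐᵒᵖ U ≃ₐ[F] Module.End D'ᵐᵒᵖ U')
    (hΦ : ∀ h, (endComponent 𝒰 h).map Φ.toLinearMap = endComponent 𝒰' h) :
    (∃ g : H, ∀ h, Module.finrank F (𝒰 h) = Module.finrank F (𝒰' (g * h))) ∧
      ∃ hT : P.T ≤ P'.T, ∀ s t : P.T, P.β s t = P'.β ⟨s, hT s.2⟩ ⟨t, hT t.2⟩ := by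
  classical
  have h𝒟 := R.isGradedDivision
  have h𝒟' := R'.isGradedDivision
  have := h𝒟.nontrivial
  have := h𝒟'.nontrivial
  have hΦm : ∀ {h f}, f ∈ endComponent 𝒰 h → Φ f ∈ endComponent 𝒰' h := fun {h f} hf => by
    rw [← hΦ, AlgEquiv.apply_mem_map_iff]
    exact hf
  have hΦs : ∀ {h f}, f ∈ endComponent 𝒰' h → Φ.symm f ∈ endComponent 𝒰 h := fun {h f} hf => by
    rw [← AlgEquiv.apply_mem_map_iff Φ, hΦ, AlgEquiv.apply_symm_apply]
    exact hf
  obtain ⟨i₀⟩ := ‹Nonempty k›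
  obtain ⟨x₀, hx₀⟩ : ∃ x, x = u i₀ := ⟨_, rfl⟩
  obtain ⟨g₀, hg₀⟩ : ∃ g, g = γ i₀ := ⟨_, rfl⟩
  have hx₀m : x₀ ∈ 𝒰 g₀ := by rw [hx₀, hg₀]; exact hu i₀
  have hx₀0 : x₀ ≠ 0 := hx₀ ▸ u.ne_zero i₀
  obtain ⟨l, hl, hlm⟩ : ∃ l : U →ₗ[Dᵐᵒᵖ] Dᵐᵒᵖ, l x₀ = 1 ∧
      ∀ h, ∀ y ∈ 𝒰 h, (l y).unop ∈ 𝒟 (g₀⁻¹ * h) :=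
    h𝒰.exists_functional h𝒟 u hu hx₀m hx₀0
  -- `r` identifies `U` with the left ideal generated by the rank-one idempotent `r x₀`.
  let r : U →ₗ[F] Module.End Dᵐᵒᵖ U :=
    { toFun := fun x => l.smulRight x
      map_add' := fun x y => by ext z; simp
      map_smul' := fun c x => by ext z; exact smul_comm (l z) c x }
  have hr : ∀ x y, r x y = l y • x := fun _ _ => rfl
  have hrm : ∀ {h x}, x ∈ 𝒰 h → r x ∈ endComponent 𝒰 (h * g₀⁻¹) := fun hx =>
    smulRight_mem_endComponent h𝒰 hlm hx
  have hcomp : ∀ f x, f * r x = r (f x) := fun f x => comp_smulRight f l x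
  have hr0 : ∀ x, r x x₀ = x := fun x => by rw [hr, hl, one_smul]
  have hrs : ∀ x d, r x (MulOpposite.op d • x₀) = MulOpposite.op d • x := fun x d => by
    rw [hr, map_smul, hl, smul_eq_mul, mul_one]
  have hre : ∀ x, r x * r x₀ = r x := fun x => by rw [hcomp, hr0]
  obtain ⟨f₀, hf₀⟩ : ∃ f, f = Φ (r x₀) := ⟨_, rfl⟩
  have hf₀m : f₀ ∈ endComponent 𝒰' 1 := by
    rw [hf₀]
    simpa using hΦm (hrm hx₀m)
  have hf₀f₀ : f₀ * f₀ = f₀ := by rw [hf₀, ← map_mul, hre]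
  have hf₀0 : f₀ ≠ 0 := by
    rw [hf₀, Ne, map_eq_zero_iff _ Φ.injective]
    intro h0
    apply hx₀0
    rw [← hr0 x₀, h0, LinearMap.zero_apply]
  obtain ⟨g₁, v, hv, hv0, hfv⟩ : ∃ g₁, ∃ v ∈ 𝒰' g₁, v ≠ 0 ∧ f₀ v = v := by
    by_contra! hcon
    apply hf₀0
    ext x
    induction x using internal_induction h𝒰'.isInternal with
    | zero => simp
    | hom g x hx =>
      by_contra h0
      refine hcon g (f₀ x) (by simpa using hf₀m g x hx) h0 ?_
      rw [← Module.End.mul_apply, hf₀f₀]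
    | add x y hx hy => rw [map_add, hx, hy]; simp
  obtain ⟨l', hl', hlm'⟩ := h𝒰'.exists_functional h𝒟' u' hu' hv hv0
  have hpm : ∀ {h y}, y ∈ 𝒰' h → l'.smulRight y ∈ endComponent 𝒰' (h * g₁⁻¹) := fun hy =>
    smulRight_mem_endComponent h𝒰' hlm' hy
  -- The image `f₀` of the idempotent again has rank one. The degree-one part of the corner cut out
  -- by `r x₀` consists of scalar multiples of `r x₀`, so `f₀ p f₀ = c f₀` for the rank-one `p`;
  -- evaluating at `v` gives `c = 1`.
  have hrange : ∀ y, f₀ y = l' (f₀ y) • v := by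
    let p : Module.End D'ᵐᵒᵖ U' := l'.smulRight v
    have hp : p ∈ endComponent 𝒰' 1 := by simpa using hpm hv
    obtain ⟨c, hc⟩ : ∃ c : F, f₀ * p * f₀ = c • f₀ := by
      have h1 : r x₀ * Φ.symm p * r x₀ = r (l (Φ.symm p x₀) • x₀) := by
        rw [mul_assoc, hcomp, hcomp, hr]
      have h2 : (l (Φ.symm p x₀)).unop ∈ 𝒟 (1 : P.T) := by
        have := hlm _ _ (hΦs hp _ _ hx₀m)
        simpa using this
      obtain ⟨c, hc⟩ : ∃ c : F, c • (1 : D) = (l (Φ.symm p x₀)).unop := by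
        have h1 : (1 : D) ∈ 𝒟 (1 : P.T) := h𝒟.grading.one_mem
        rw [R.component_eq, Submodule.mem_span_singleton] at h1 h2
        obtain ⟨a, ha⟩ := h1
        obtain ⟨b, hb⟩ := h2
        have ha0 : a ≠ 0 := by
          rintro rfl
          exact one_ne_zero (α := D) (by rw [← ha, zero_smul])
        exact ⟨b * a⁻¹, by rw [← ha, smul_smul, inv_mul_cancel_right₀ ha0, hb]⟩
      have h3 : l (Φ.symm p x₀) = c • (1 : Dᵐᵒᵖ) := MulOpposite.unop_injective hc.symm
      rw [h3, smul_assoc, one_smul, map_smul] at h1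
      refine ⟨c, ?_⟩
      have := congrArg Φ h1
      rwa [map_mul, map_mul, AlgEquiv.apply_symm_apply, map_smul, ← hf₀] at this
    have hpv : p v = v := by simp [p, hl']
    have hc1 : c = 1 := by
      have := LinearMap.congr_fun hc v
      rw [Module.End.mul_apply, Module.End.mul_apply, hfv, hpv, hfv, LinearMap.smul_apply,
        hfv] at this
      by_contra hne
      have h0 : (c - 1) • v = 0 := by rw [sub_smul, one_smul, ← this, sub_self]
      exact hv0 ((smul_eq_zero.1 h0).resolve_left (sub_ne_zero.2 hne))
    intro y
    have := LinearMap.congr_fun hc y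
    rw [hc1, one_smul, Module.End.mul_apply, Module.End.mul_apply] at this
    conv_lhs => rw [← this]
    change f₀ (l' (f₀ y) • v) = _
    rw [map_smul, hfv]
  -- The left ideals of `r x₀` and `f₀` correspond under `Φ`; evaluating the second at `v` gives
  -- `U'` with degrees shifted.
  let Θ : U →ₗ[F] U' :=
    { toFun := fun x => Φ (r x) v
      map_add' := fun x y => by simp
      map_smul' := fun c x => by simp }
  have hΘ : ∀ x, Θ x = Φ (r x) v := fun _ => rfl
  have hΘm : ∀ {h x}, x ∈ 𝒰 h → Θ x ∈ 𝒰' (h * g₀⁻¹ * g₁) := fun hx => hΦm (hrm hx) _ _ hv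
  have hΘinj : Function.Injective Θ := by
    rw [injective_iff_map_eq_zero]
    intro x hx
    have h0 : Φ (r x) = 0 := by
      ext y
      rw [← hre x, map_mul, ← hf₀, Module.End.mul_apply, hrange, map_smul, ← hΘ, hx, smul_zero,
        LinearMap.zero_apply]
    rw [map_eq_zero_iff _ Φ.injective] at h0
    rw [← hr0 x, h0, LinearMap.zero_apply]
  have hΘsurj : ∀ h, (𝒰 h).map Θ = 𝒰' (h * g₀⁻¹ * g₁) := by
    intro h
    apply le_antisymm
    · rintro _ ⟨x, hx, rfl⟩
      exact hΘm hx
    · intro y hy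
      have hq := hpm hy
      rw [mul_inv_cancel_right] at hq
      -- The preimage of `y` comes from the rank-one operator sending `v` to `y`.
      refine ⟨Φ.symm (l'.smulRight y) x₀, ?_, ?_⟩
      · have := hΦs hq _ _ hx₀m
        rwa [inv_mul_cancel_right] at this
      · rw [hΘ, ← hcomp, map_mul, AlgEquiv.apply_symm_apply, ← hf₀, Module.End.mul_apply, hfv,
          LinearMap.smulRight_apply, hl', one_smul]
  refine ⟨⟨g₀⁻¹ * g₁, fun h => ?_⟩, ?_⟩
  · rw [mul_comm _ h, ← mul_assoc, ← hΘsurj]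
    exact (Submodule.equivMapOfInjective Θ hΘinj (𝒰 h)).finrank_eq
  -- `Θ` carries the line `x₀ D` into `v D'`; reading off coefficients gives a degree-preserving
  -- multiplicative map, which transports the commutation relations.
  let θ : D → D' := fun d => (l' (Θ (MulOpposite.op d • x₀))).unop
  have hθv : ∀ d, Θ (MulOpposite.op d • x₀) = MulOpposite.op (θ d) • v := by
    intro d
    have h1 : r (MulOpposite.op d • x₀) = r x₀ * r (MulOpposite.op d • x₀) := by
      rw [hcomp, hrs]
    have h2 : Θ (MulOpposite.op d • x₀) = f₀ (Θ (MulOpposite.op d • x₀)) := by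
      rw [hΘ, hf₀, ← Module.End.mul_apply, ← map_mul, ← h1]
    rw [h2, hrange, ← h2]
    rfl
  have hθm : ∀ {t : H} {d}, d ∈ 𝒟 t → θ d ∈ 𝒟' t := by
    intro t d hd
    have := hlm' _ _ (hΘm (h𝒰.smul_mem _ _ _ _ hx₀m hd))
    rwa [mul_comm g₀ t, mul_inv_cancel_right, mul_comm t, inv_mul_cancel_left] at this
  have hθ0 : ∀ {d}, d ≠ 0 → θ d ≠ 0 := by
    intro d hd h0
    have h1 := hθv d
    rw [h0, MulOpposite.op_zero, zero_smul, map_eq_zero_iff _ hΘinj] at h1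
    have h2 := congrArg l h1
    rw [map_smul, hl, map_zero, smul_eq_mul, mul_one, MulOpposite.op_eq_zero_iff] at h2
    exact hd h2
  have hθmul : ∀ d d', θ (d * d') = θ d * θ d' := by
    intro d d'
    have h1 : Θ (MulOpposite.op (d * d') • x₀) = MulOpposite.op (θ d * θ d') • v := by
      have h2 : r (MulOpposite.op (d * d') • x₀) =
          r (MulOpposite.op d • x₀) * r (MulOpposite.op d' • x₀) := by
        rw [hcomp, hrs, MulOpposite.op_mul, mul_smul]
      rw [hΘ, h2, map_mul, Module.End.mul_apply, ← hΘ, hθv, map_smul, ← hΘ, hθv,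
        MulOpposite.op_mul, mul_smul]
    change (l' _).unop = _
    rw [h1, map_smul, hl', smul_eq_mul, mul_one, MulOpposite.unop_op]
  have hθsmul : ∀ (c : F) d, θ (c • d) = c • θ d := by
    intro c d
    change (l' _).unop = c • (l' _).unop
    rw [MulOpposite.op_smul, smul_assoc, map_smul, ← MulOpposite.unop_smul,
      ← one_smul D'ᵐᵒᵖ (Θ _), ← smul_assoc, map_smul, smul_assoc, one_smul, one_smul]
  have hT : P.T ≤ P'.T := by
    intro t ht
    rw [← R'.component_ne_bot_iff]
    intro hbot
    have := hθm (R.X_mem ⟨t, ht⟩)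
    rw [show ((⟨t, ht⟩ : P.T) : H) = t from rfl, hbot, Submodule.mem_bot] at this
    exact hθ0 (R.X.ne_zero _) this
  refine ⟨hT, fun s t => ?_⟩
  have h1 := congrArg θ (R.comm s t)
  rw [hθmul, hθsmul, hθmul] at h1
  have h2 := R'.comm_of_mem (s := ⟨s, hT s.2⟩) (t := ⟨t, hT t.2⟩) (hθm (R.X_mem s))
    (hθm (R.X_mem t))
  rw [h2] at h1
  have h3 : θ (R.X t) * θ (R.X s) ≠ 0 := h𝒟'.mul_ne_zero (hθm (R.X_mem t)) (hθ0 (R.X.ne_zero _))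
    (hθm (R.X_mem s)) (hθ0 (R.X.ne_zero _))
  exact Units.ext (smul_left_injective F h3 h1).symm

end Uniqueness

/-! ### The isomorphism criterion for gradings by an arbitrary abelian group. -/

section Isomorphism

variable {F : Type*} [Field F] {H : Type*} [CommGroup H]

theorem Realization.finrank_component {P : DivisionDatum F H} {D : Type*} [Ring D] [Algebra F D]
    {𝒟 : H → Submodule F D} (R : Realization P 𝒟) (h : H) [Decidable (h ∈ P.T)] :
    Module.finrank F (𝒟 h) = if h ∈ P.T then 1 else 0 := by
  split_ifs with hh
  · rw [R.component_eq ⟨h, hh⟩]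
    exact finrank_span_singleton (R.X.ne_zero _)
  · rw [R.component_eq_bot hh, finrank_bot]

/-- The `i`-th coordinate contributes the component of degree `γ_i⁻¹ h`, which is a line when `h`
lies in `γ_i T` and zero otherwise. Thus dimensions encode the coset multiset. -/
theorem Realization.finrank_freeGrading {P : DivisionDatum F H} {D : Type*} [Ring D] [Algebra F D]
    {𝒟 : H → Submodule F D} (R : Realization P 𝒟) {k : ℕ} (γ : Fin k → H) (h : H)
    [DecidableEq (H ⧸ P.T)] :
    Module.finrank F (freeGrading 𝒟 γ h) = (cosetMultiset P.T γ).count (h : H ⧸ P.T) := by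
  classical
  have := R.finiteDimensional
  let e : freeGrading 𝒟 γ h ≃ₗ[F] ∀ i, 𝒟 ((γ i)⁻¹ * h) :=
    { toFun := fun x i => ⟨(x.1 i).unop, x.2 i⟩
      invFun := fun y => ⟨fun i => MulOpposite.op (y i).1, fun i => (y i).2⟩
      map_add' := fun _ _ => rfl
      map_smul' := fun _ _ => rfl
      left_inv := fun _ => rfl
      right_inv := fun _ => rfl }
  rw [e.finrank_eq, Module.finrank_pi_fintype, cosetMultiset, Multiset.count_map]
  simp only [R.finrank_component]
  rw [Finset.sum_boole, Nat.cast_id, ← Finset.filter_val, Finset.card_val]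
  congr 1
  ext i
  simp only [Finset.mem_filter, Finset.mem_univ, true_and]
  rw [eq_comm, QuotientGroup.eq]

theorem exists_perm_of_map_univ_eq {k α : Type*} [Fintype k] {f f' : k → α}
    (h : (Finset.univ : Finset k).val.map f = (Finset.univ : Finset k).val.map f') :
    ∃ σ : Equiv.Perm k, ∀ i, f (σ i) = f' i := by
  classical
  have hc : ∀ a, Nonempty ({i // f' i = a} ≃ {i // f i = a}) := by
    intro a
    have ha := congrArg (Multiset.count a) h
    rw [Multiset.count_map, Multiset.count_map, ← Finset.filter_val, ← Finset.filter_val,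
      Finset.card_val, Finset.card_val] at ha
    rw [← Fintype.card_eq, Fintype.card_subtype, Fintype.card_subtype]
    simpa only [eq_comm] using ha.symm
  let e : ∀ a, {i // f' i = a} ≃ {i // f i = a} := fun a => (hc a).some
  refine ⟨((Equiv.sigmaFiberEquiv f').symm.trans (Equiv.sigmaCongrRight e)).trans
    (Equiv.sigmaFiberEquiv f), fun i => ?_⟩
  exact (e (f' i) ⟨i, rfl⟩).2

theorem DivisionDatum.eq_of_beta_eq {P P' : DivisionDatum F H} (hT : P.T = P'.T)
    (hβ : ∀ s t : P.T, P.β s t = P'.β ⟨s, hT ▸ s.2⟩ ⟨t, hT ▸ t.2⟩) : P = P' := by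
  obtain ⟨T, hfin, β, halt, hnd⟩ := P
  obtain ⟨T', hfin', β', halt', hnd'⟩ := P'
  dsimp only at hT
  subst hT
  congr 1
  ext s t
  exact congrArg Units.val (hβ s t)

/-- The graded algebra determined by `(T, β, γ)` only depends on `(T, β)` and on the multiset of
cosets of `γ` up to a shift. -/
theorem exists_algEquiv_matrixGrading [IsAlgClosed F] {P P' : DivisionDatum F H}
    (hT : P.T = P'.T) (hβ : ∀ s t : P.T, P.β s t = P'.β ⟨s, hT ▸ s.2⟩ ⟨t, hT ▸ t.2⟩)
    (S : Polarization P) (S' : Polarization P') {k k' : ℕ} (γ : Fin k → H) (γ' : Fin k' → H) (g : H)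
    (h : (cosetMultiset P.T γ).map (fun c => g • c) = cosetMultiset P.T γ') :
    ∃ φ : Matrix (Fin k × S.B) (Fin k × S.B) F ≃ₐ[F] Matrix (Fin k' × S'.B) (Fin k' × S'.B) F,
      ∀ x, (matrixGrading S γ x).map φ.toLinearMap = matrixGrading S' γ' x := by
  obtain rfl : P = P' := DivisionDatum.eq_of_beta_eq hT hβ
  obtain rfl : k = k' := by simpa [cosetMultiset] using congrArg Multiset.card h
  have h' : (Finset.univ : Finset (Fin k)).val.map (fun i => ((g * γ i : H) : H ⧸ P.T)) =
      (Finset.univ : Finset (Fin k)).val.map (fun i => (γ' i : H ⧸ P.T)) := by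
    rw [← cosetMultiset.eq_1 P.T γ', ← h, cosetMultiset, Multiset.map_map]
    rfl
  obtain ⟨σ, hσ⟩ := exists_perm_of_map_univ_eq h'
  let R := standardRealization S
  have h𝒟 := R.isGradedDivision.grading
  have h𝒰 := isGradedRightModule_freeGrading h𝒟 γ
  have ht : ∀ i, (g * γ (σ i))⁻¹ * γ' i ∈ P.T := fun i => QuotientGroup.eq.1 (hσ i)
  obtain ⟨Φ, hΦ⟩ := exists_end_algEquiv_matrix R S h𝒰 (Pi.basisFun _ _)
    (basisFun_mem_freeGrading h𝒟 γ)
  have h𝒰' := isGradedRightModule_freeGrading h𝒟 (fun i => g * γ i)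
  -- Matching cosets differ by elements of `T`, so multiplying the permuted basis vectors by the
  -- corresponding `X_t` gives them degrees exactly `γ'`.
  let u' := ((Pi.basisFun (Matrix S.B S.B F)ᵐᵒᵖ (Fin k)).reindex σ.symm).isUnitSMul
    (w := fun i => MulOpposite.op (R.X ⟨_, ht i⟩)) (fun i => (R.isUnit _).op)
  obtain ⟨Φ', hΦ'⟩ := exists_end_algEquiv_matrix R S' h𝒰' (γ := γ') u' (by
    intro i
    have h1 := basisFun_mem_freeGrading h𝒟 (fun i => g * γ i) (σ i)
    have h2 := h𝒰'.smul_mem _ _ _ _ h1 (R.X_mem ⟨_, ht i⟩)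
    rw [mul_inv_cancel_left] at h2
    simpa [u', Module.Basis.isUnitSMul_apply] using h2)
  -- A global shift of the module does not change the degrees of its endomorphisms.
  have hend : ∀ x, endComponent (D := Matrix S.B S.B F)
      (freeGrading (standardGrading S) fun i => g * γ i) x =
      endComponent (D := Matrix S.B S.B F) (freeGrading (standardGrading S) γ) x := by
    have hs : ∀ y, freeGrading (standardGrading S) (fun i => g * γ i) (g * y) =
        freeGrading (standardGrading S) γ y := by
      intro y
      ext z
      refine forall_congr' fun i => ?_
      rw [mul_inv, mul_mul_mul_comm, inv_mul_cancel, one_mul]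
    intro x
    ext f
    constructor
    · intro hf y z hz
      rw [← hs] at hz ⊢
      rw [mul_left_comm]
      exact hf _ _ hz
    · intro hf y z hz
      rw [← mul_inv_cancel_left g y, hs] at hz
      have := hf _ _ hz
      rwa [← hs, mul_left_comm, mul_inv_cancel_left] at this
  refine ⟨Φ.symm.trans Φ', fun x => ?_⟩
  rw [← hΦ', ← hΦ, hend]
  ext M
  obtain ⟨f, rfl⟩ := Φ'.surjective M
  rw [AlgEquiv.apply_mem_map_iff]
  conv_lhs => rw [← Φ.symm_apply_apply f, ← AlgEquiv.trans_apply, AlgEquiv.apply_mem_map_iff,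
    AlgEquiv.apply_mem_map_iff]

/-- The invariants `T`, `β` and the multiset of cosets up to a shift. -/
theorem invariants_of_algEquiv_matrixGrading [IsAlgClosed F] {P P' : DivisionDatum F H}
    (S : Polarization P) (S' : Polarization P') {k k' : ℕ} (γ : Fin k → H) (γ' : Fin k' → H)
    (hk : 0 < k) (hk' : 0 < k')
    (φ : Matrix (Fin k × S.B) (Fin k × S.B) F ≃ₐ[F] Matrix (Fin k' × S'.B) (Fin k' × S'.B) F)
    (hφ : ∀ x, (matrixGrading S γ x).map φ.toLinearMap = matrixGrading S' γ' x) :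
    ∃ hT : P.T = P'.T, (∀ s t : P.T, P.β s t = P'.β ⟨s, hT ▸ s.2⟩ ⟨t, hT ▸ t.2⟩) ∧
      ∃ g : H, (cosetMultiset P.T γ).map (fun c => g • c) = cosetMultiset P.T γ' := by
  classical
  have : NeZero k := ⟨hk.ne'⟩
  have : NeZero k' := ⟨hk'.ne'⟩
  let R := standardRealization S
  have h𝒟 := R.isGradedDivision.grading
  have h𝒰 := isGradedRightModule_freeGrading h𝒟 γ
  let R' := standardRealization S'
  have h𝒟' := R'.isGradedDivision.grading
  have h𝒰' := isGradedRightModule_freeGrading h𝒟' γ'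
  obtain ⟨Φ, hΦ⟩ := exists_end_algEquiv_matrix R S h𝒰 (Pi.basisFun _ _)
    (basisFun_mem_freeGrading h𝒟 γ)
  obtain ⟨Φ', hΦ'⟩ := exists_end_algEquiv_matrix R' S' h𝒰' (Pi.basisFun _ _)
    (basisFun_mem_freeGrading h𝒟' γ')
  let Ψ := (Φ.trans φ).trans Φ'.symm
  have hmem : ∀ h f, Ψ f ∈ endComponent (freeGrading (standardGrading S') γ') h ↔
      f ∈ endComponent (freeGrading (standardGrading S) γ) h := by
    intro h f
    rw [← AlgEquiv.apply_mem_map_iff Φ', hΦ', ← hφ, ← hΦ]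
    simp only [Ψ, AlgEquiv.trans_apply, AlgEquiv.apply_symm_apply]
    rw [AlgEquiv.apply_mem_map_iff, AlgEquiv.apply_mem_map_iff]
  obtain ⟨⟨g, hg⟩, hT, hβ⟩ := exists_shift_of_end_algEquiv R h𝒰 (Pi.basisFun _ _)
    (basisFun_mem_freeGrading h𝒟 γ) R' h𝒰' (Pi.basisFun _ _)
    (basisFun_mem_freeGrading h𝒟' γ') Ψ (by
      intro h
      ext f
      obtain ⟨f, rfl⟩ := Ψ.surjective f
      rw [AlgEquiv.apply_mem_map_iff, hmem])
  -- The inverse isomorphism supplies the reverse inclusion of supports.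
  obtain ⟨-, hT', -⟩ := exists_shift_of_end_algEquiv R' h𝒰' (Pi.basisFun _ _)
    (basisFun_mem_freeGrading h𝒟' γ') R h𝒰 (Pi.basisFun _ _)
    (basisFun_mem_freeGrading h𝒟 γ) Ψ.symm (by
      intro h
      ext f
      obtain ⟨f, rfl⟩ := Ψ.symm.surjective f
      rw [AlgEquiv.apply_mem_map_iff, ← hmem, AlgEquiv.apply_symm_apply])
  have hTT := le_antisymm hT hT'
  refine ⟨hTT, hβ, g, ?_⟩
  ext c
  obtain ⟨x, rfl⟩ := QuotientGroup.mk_surjective c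
  have h1 : (x : H ⧸ P.T) = g • ((g⁻¹ * x : H) : H ⧸ P.T) := by
    rw [MulAction.Quotient.smul_coe, smul_eq_mul, mul_inv_cancel_left]
  conv_lhs => rw [h1]
  rw [Multiset.count_map_eq_count' _ _ (MulAction.injective g), ← R.finrank_freeGrading, hg,
    mul_inv_cancel_left, R'.finrank_freeGrading]
  rw [cosetMultiset, cosetMultiset, Multiset.count_map, Multiset.count_map]
  simp only [QuotientGroup.eq, hTT]

end Isomorphism

/-! ### Passing between `G × ℤ₂`-gradings and superalgebra gradings. -/

section Components

theorem zmod_two_cases (x : Multiplicative (ZMod 2)) :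
    x = 1 ∨ x = Multiplicative.ofAdd (1 : ZMod 2) := by
  revert x
  decide

variable {F : Type*} [Field F] {G : Type*} {A : Type*} [Ring A] [Algebra F A]

theorem iSup_zmod_two {L : Type*} [CompleteLattice L] (f : ZMod 2 → L) :
    ⨆ i, f i = f 0 ⊔ f 1 := by
  apply le_antisymm
  · refine iSup_le fun i => ?_
    fin_cases i
    · exact le_sup_left
    · exact le_sup_right
  · exact sup_le (le_iSup f 0) (le_iSup f 1)

theorem groupComponents_sharpGrading [CommGroup G] {par : ZMod 2 → Submodule F A}
    {𝒜 : G → Submodule F A} (h : IsSuperalgebraGrading par 𝒜) :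
    groupComponents (sharpGrading par 𝒜) = 𝒜 := by
  ext1 g
  rw [groupComponents, iSup_zmod_two]
  exact (h.compatible g).symm

/-- The recovered parity components lie in `par` and together span the algebra, so disjointness of
`par 0` and `par 1` forces equality. -/
theorem parityComponents_sharpGrading [CommGroup G] {par : ZMod 2 → Submodule F A}
    {𝒜 : G → Submodule F A} (h : IsSuperalgebraGrading par 𝒜) (hpar : Disjoint (par 0) (par 1)) :
    parityComponents (sharpGrading par 𝒜) = par := by
  have hle : ∀ i, parityComponents (sharpGrading par 𝒜) i ≤ par i := fun i =>
    iSup_le fun g => inf_le_right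
  have htop : ∀ x, ∃ y ∈ parityComponents (sharpGrading par 𝒜) 0,
      ∃ z ∈ parityComponents (sharpGrading par 𝒜) 1, y + z = x := by
    classical
    intro x
    rw [← Submodule.mem_sup]
    induction x using internal_induction h.grading.isInternal with
    | zero => exact zero_mem _
    | hom g x hx =>
      rw [h.compatible g] at hx
      exact sup_le_sup (le_iSup (fun g => sharpGrading par 𝒜 (g, Multiplicative.ofAdd 0)) g)
        (le_iSup (fun g => sharpGrading par 𝒜 (g, Multiplicative.ofAdd 1)) g) hx
    | add x y hx hy => exact add_mem hx hy
  ext1 i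
  apply le_antisymm (hle i)
  intro x hx
  obtain ⟨y, hy, z, hz, rfl⟩ := htop x
  rw [Submodule.disjoint_def] at hpar
  have hcases : ∀ j : ZMod 2, j = 0 ∨ j = 1 := by decide
  obtain rfl | rfl := hcases i
  · rw [hpar z ((Submodule.add_mem_iff_right _ (hle 0 hy)).1 hx) (hle 1 hz), add_zero]
    exact hy
  · rw [hpar y (hle 0 hy) ((Submodule.add_mem_iff_left _ (hle 1 hz)).1 hx), zero_add]
    exact hz

theorem groupComponents_mul_mem [CommGroup G] {ℬ : Sharp G → Submodule F A}
    (hℬ : ∀ x y a b, a ∈ ℬ x → b ∈ ℬ y → a * b ∈ ℬ (x * y)) {g h : G} {a b : A}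
    (ha : a ∈ groupComponents ℬ g) (hb : b ∈ groupComponents ℬ h) :
    a * b ∈ groupComponents ℬ (g * h) := by
  refine Submodule.iSup_induction (fun i : ZMod 2 => ℬ (g, Multiplicative.ofAdd i))
    (motive := fun a => a * b ∈ groupComponents ℬ (g * h)) ha
    (fun i a ha => ?_) (by simp) (fun a a' h h' => by rw [add_mul]; exact add_mem h h')
  refine Submodule.iSup_induction (fun i : ZMod 2 => ℬ (h, Multiplicative.ofAdd i))
    (motive := fun b => a * b ∈ groupComponents ℬ (g * h)) hb
    (fun j b hb => ?_) (by simp) (fun a a' h h' => by rw [mul_add]; exact add_mem h h')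
  exact Submodule.mem_iSup_of_mem (p := fun i : ZMod 2 => ℬ (g * h, Multiplicative.ofAdd i))
    (i + j) (hℬ _ _ _ _ ha hb)

theorem gradedSuperIso_of_map_eq {B : Type*} [Ring B] [Algebra F B]
    {𝒜 : Sharp G → Submodule F A} {ℬ : Sharp G → Submodule F B} (φ : A ≃ₐ[F] B)
    (h : ∀ x, (𝒜 x).map φ.toLinearMap = ℬ x) :
    GradedSuperIso (parityComponents 𝒜) (groupComponents 𝒜)
      (parityComponents ℬ) (groupComponents ℬ) := by
  refine ⟨φ, fun i => ?_, fun g => ?_⟩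
  · simp only [parityComponents, Submodule.map_iSup, h]
  · simp only [groupComponents, Submodule.map_iSup, h]

end Components

/-! ### The homogeneous basis `E_{ij} ⊗ X_t` and the units `1 ⊗ X_t`. -/

section MatrixBasis

variable {F : Type*} [Field F] {H : Type*} [CommGroup H] {P : DivisionDatum F H}

/-- The basis `E_{ij} ⊗ X_t` of `M_k(F) ⊗ 𝒟`. -/
def matrixBasis (S : Polarization P) (k : ℕ) :
    Module.Basis (Fin k × Fin k × (S.A × S.B)) F (Matrix (Fin k × S.B) (Fin k × S.B) F) :=
  ((standardBasis S).matrix (Fin k) (Fin k)).map (Matrix.compAlgEquiv _ _ _ _).toLinearEquiv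

/-- The degrees of the elements `E_{ij} ⊗ X_t`. -/
def matrixDegree (S : Polarization P) {k : ℕ} (γ : Fin k → H)
    (x : Fin k × Fin k × (S.A × S.B)) : H :=
  γ x.1 * S.equiv x.2.2 * (γ x.2.1)⁻¹

theorem matrixGrading_eq_span (S : Polarization P) {k : ℕ} (γ : Fin k → H) (h : H) :
    matrixGrading S γ h = Submodule.span F (matrixBasis S k '' {x | matrixDegree S γ x = h}) := by
  have key : ∀ i j a b, matrixBasis S k (i, j, (a, b)) =
      (Matrix.single i j (1 : F)) ⊗ₖ (standardX S a b) := by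
    intro i j a b
    rw [matrixBasis, Module.Basis.map_apply, Module.Basis.matrix_apply, standardBasis_apply]
    ext ⟨i', x⟩ ⟨j', y⟩
    change Matrix.single i j (standardX S a b) i' j' x y = _
    rw [Matrix.kroneckerMap_apply, Matrix.single_apply, Matrix.single_apply]
    split_ifs <;> simp
  rw [matrixGrading]
  congr 1
  ext M
  constructor
  · rintro ⟨i, j, a, b, h, rfl⟩
    exact ⟨(i, j, (a, b)), h, key _ _ _ _⟩
  · rintro ⟨⟨i, j, a, b⟩, h, rfl⟩
    exact ⟨i, j, a, b, h, key _ _ _ _⟩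

theorem matrixGrading_mul_mem (S : Polarization P) {k : ℕ} (γ : Fin k → H) {g h : H}
    {M N : Matrix (Fin k × S.B) (Fin k × S.B) F} (hM : M ∈ matrixGrading S γ g)
    (hN : N ∈ matrixGrading S γ h) : M * N ∈ matrixGrading S γ (g * h) := by
  obtain ⟨M, rfl⟩ := (Matrix.compAlgEquiv (Fin k) S.B F F).surjective M
  obtain ⟨N, rfl⟩ := (Matrix.compAlgEquiv (Fin k) S.B F F).surjective N
  rw [mem_matrixGrading_iff] at hM hN
  rw [← map_mul, mem_matrixGrading_iff]
  intro i j
  rw [Matrix.mul_apply]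
  refine sum_mem fun l _ => ?_
  have := (standardRealization S).isGradedDivision.grading.mul_mem _ _ _ _ (hM i l) (hN l j)
  convert this using 2
  rw [mul_assoc, mul_assoc, mul_assoc g, mul_inv_cancel_left]

/-- The matrix `1 ⊗ X_t`. -/
def scalarX (S : Polarization P) (k : ℕ) (t : P.T) : Matrix (Fin k × S.B) (Fin k × S.B) F :=
  Matrix.compAlgEquiv (Fin k) S.B F F (Matrix.scalar (Fin k) ((standardRealization S).X t))

theorem isUnit_scalarX (S : Polarization P) (k : ℕ) (t : P.T) : IsUnit (scalarX S k t) :=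
  (((standardRealization S).isUnit t).map (Matrix.scalar (Fin k))).map
    (Matrix.compAlgEquiv (Fin k) S.B F F)

theorem scalarX_mem (S : Polarization P) {k : ℕ} (γ : Fin k → H) (t : P.T) :
    scalarX S k t ∈ matrixGrading S γ t := by
  rw [scalarX, mem_matrixGrading_iff]
  intro i j
  rw [Matrix.scalar_apply]
  rcases eq_or_ne i j with rfl | hij
  · rw [Matrix.diagonal_apply_eq, mul_comm, mul_inv_cancel_right]
    exact (standardRealization S).X_mem t
  · rw [Matrix.diagonal_apply_ne _ hij]
    exact zero_mem _

theorem exists_scalarX_mul_self (S : Polarization P) (k : ℕ) {t : P.T} (ht : t * t = 1) :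
    ∃ c : Fˣ, scalarX S k t * scalarX S k t = (c : F) • 1 := by
  obtain ⟨c, hc⟩ := (standardRealization S).mul t t
  obtain ⟨d, hd⟩ : ∃ d : F, (standardRealization S).X 1 = d • 1 := by
    have h1 : (1 : Matrix S.B S.B F) ∈ standardGrading S (1 : P.T) :=
      (standardRealization S).isGradedDivision.grading.one_mem
    obtain ⟨s, d, hs, hd, h⟩ := (standardRealization S).mem_component h1 one_ne_zero
    obtain rfl : s = 1 := Subtype.ext hs
    exact ⟨d⁻¹, by rw [h, inv_smul_smul₀ hd]⟩
  rw [ht, hd, smul_smul] at hc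
  have hu := ((standardRealization S).isUnit t).mul ((standardRealization S).isUnit t)
  have h0 : c * d ≠ 0 := by
    intro h0
    rw [hc, h0, zero_smul] at hu
    exact not_isUnit_zero hu
  refine ⟨Units.mk0 _ h0, ?_⟩
  rw [scalarX, ← map_mul, ← map_mul, hc, Units.val_mk0,
    ← map_one (Matrix.compAlgEquiv (Fin k) S.B F F), ← map_smul]
  congr 1
  ext1 i j
  rw [Matrix.scalar_apply, Matrix.smul_apply, Matrix.diagonal_apply, Matrix.one_apply]
  split_ifs <;> simp

end MatrixBasis

/-! ### The superalgebra gradings `Γ(T, β, γ)` and their isomorphism criterion. -/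

section Odd

variable {F : Type*} [Field F] {G : Type*} [CommGroup G] (Q : OddDatum F G)
  (S : Polarization Q.toDivisionDatum)

theorem oddGrading_eq_span (g : G) : oddGrading Q S g = Submodule.span F
    (matrixBasis S Q.k '' {x | (matrixDegree S Q.γSharp x).1 = g}) := by
  simp only [oddGrading, groupComponents, oddSharp, matrixGrading_eq_span]
  rw [Basis.iSup_span_image]
  congr 2
  ext x
  simp only [Set.mem_iUnion, Set.mem_ofPred_eq, Prod.ext_iff, exists_and_left, and_iff_left_iff_imp]
  exact fun _ => ⟨_, rfl⟩

theorem oddParity_eq_span (i : ZMod 2) : oddParity Q S i = Submodule.span F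
    (matrixBasis S Q.k '' {x | (matrixDegree S Q.γSharp x).2 = Multiplicative.ofAdd i}) := by
  simp only [oddParity, parityComponents, oddSharp, matrixGrading_eq_span]
  rw [Basis.iSup_span_image]
  congr 2
  ext x
  simp [Prod.ext_iff]

theorem sharpGrading_odd (x : Sharp G) :
    sharpGrading (oddParity Q S) (oddGrading Q S) x = oddSharp Q S x := by
  rw [sharpGrading, oddGrading_eq_span, oddParity_eq_span, Basis.span_image_inf, oddSharp,
    matrixGrading_eq_span]
  congr 2
  ext y
  simp [Prod.ext_iff]

theorem isInternal_oddGrading [DecidableEq G] : DirectSum.IsInternal (oddGrading Q S) := by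
  rw [funext (oddGrading_eq_span Q S)]
  exact Basis.isInternal_span_image (matrixBasis S Q.k) fun x => (matrixDegree S Q.γSharp x).1

theorem oddGrading_mul_mem (g h : G) (a b : Matrix (Fin Q.k × S.B) (Fin Q.k × S.B) F)
    (ha : a ∈ oddGrading Q S g) (hb : b ∈ oddGrading Q S h) : a * b ∈ oddGrading Q S (g * h) :=
  groupComponents_mul_mem (ℬ := oddSharp Q S)
    (fun _ _ _ _ => matrixGrading_mul_mem S Q.γSharp) ha hb

theorem isGrading_odd : IsGrading (oddGrading Q S) := by
  refine ⟨?_, oddGrading_mul_mem Q S⟩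
  exact @isInternal_oddGrading _ _ _ _ Q S (Classical.decEq G)

theorem isSuperalgebraGrading_odd : IsSuperalgebraGrading (oddParity Q S) (oddGrading Q S) := by
  refine ⟨isGrading_odd Q S, fun g => ?_⟩
  change oddGrading Q S g = sharpGrading (oddParity Q S) (oddGrading Q S)
    (g, Multiplicative.ofAdd 0) ⊔ sharpGrading (oddParity Q S) (oddGrading Q S)
    (g, Multiplicative.ofAdd 1)
  rw [sharpGrading_odd, sharpGrading_odd, oddGrading, groupComponents, iSup_zmod_two]

theorem oddParity_sup_eq_top : oddParity Q S 0 ⊔ oddParity Q S 1 = ⊤ := by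
  rw [← iSup_zmod_two, funext (oddParity_eq_span Q S), Basis.iSup_span_image,
    show (⋃ i : ZMod 2, _) = Set.univ from ?_, Set.image_univ, Module.Basis.span_eq]
  ext x
  simp only [Set.mem_iUnion, Set.mem_ofPred_eq, Set.mem_univ, iff_true]
  exact ⟨_, rfl⟩

theorem OddDatum.exists_odd : ∃ t : Q.T, (t : Sharp G).2 = Multiplicative.ofAdd (1 : ZMod 2) := by
  obtain ⟨t, ht, ht'⟩ := SetLike.not_le_iff_exists.1 Q.not_even
  exact ⟨⟨t, ht⟩, (zmod_two_cases t.2).resolve_left ht'⟩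

theorem map_oddSharp_of_gradedSuperIso {F : Type*} [Field F] {G : Type*} [CommGroup G]
    {Q Q' : OddDatum F G} {S : Polarization Q.toDivisionDatum}
    {S' : Polarization Q'.toDivisionDatum}
    (h : GradedSuperIso (oddParity Q S) (oddGrading Q S) (oddParity Q' S') (oddGrading Q' S')) :
    ∃ φ : Matrix (Fin Q.k × S.B) (Fin Q.k × S.B) F ≃ₐ[F]
        Matrix (Fin Q'.k × S'.B) (Fin Q'.k × S'.B) F,
      ∀ x, (oddSharp Q S x).map φ.toLinearMap = oddSharp Q' S' x := by
  obtain ⟨φ, hpar, hgr⟩ := h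
  refine ⟨φ, fun x => ?_⟩
  rw [← sharpGrading_odd, ← sharpGrading_odd, sharpGrading, sharpGrading, ← hpar, ← hgr]
  exact Submodule.map_inf φ.toLinearMap φ.injective

/-- The isomorphism criterion for the gradings `Γ(T, β, γ)`. -/
theorem gradedSuperIso_odd_iff [IsAlgClosed F] (Q Q' : OddDatum F G)
    (S : Polarization Q.toDivisionDatum) (S' : Polarization Q'.toDivisionDatum) :
    GradedSuperIso (oddParity Q S) (oddGrading Q S) (oddParity Q' S') (oddGrading Q' S') ↔
      ∃ hT : Q.T = Q'.T,
        (∀ s t : Q.T, Q.β s t = Q'.β ⟨s, hT ▸ s.2⟩ ⟨t, hT ▸ t.2⟩) ∧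
        ∃ g : G,
          (cosetMultiset Q.T Q.γSharp).map (fun c => ((g, 1) : Sharp G) • c) =
            cosetMultiset Q.T Q'.γSharp := by
  constructor
  · intro h
    obtain ⟨φ, hφ⟩ := map_oddSharp_of_gradedSuperIso h
    obtain ⟨hT, hβ, g, hg⟩ := invariants_of_algEquiv_matrixGrading S S' _ _ Q.k_pos Q'.k_pos φ hφ
    refine ⟨hT, hβ, ?_⟩
    obtain ⟨g, e⟩ := g
    rcases zmod_two_cases e with rfl | rfl
    · exact ⟨g, hg⟩
    -- An odd shift is multiplied by an odd element of `T`: the product lies in `G` and acts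
    -- identically on cosets of `T`.
    · obtain ⟨⟨⟨t, e⟩, ht⟩, rfl⟩ := Q.exists_odd
      refine ⟨g * t, ?_⟩
      rw [← hg]
      refine Multiset.map_congr rfl fun c _ => ?_
      obtain ⟨x, rfl⟩ := QuotientGroup.mk_surjective c
      rw [MulAction.Quotient.smul_coe, MulAction.Quotient.smul_coe, eq_comm, QuotientGroup.eq]
      convert ht using 1
      simp only [smul_eq_mul]
      rw [mul_inv, mul_mul_mul_comm, inv_mul_cancel, mul_one]
      ext
      · simp
      · simp
  · rintro ⟨hT, hβ, g, hg⟩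
    obtain ⟨φ, hφ⟩ := exists_algEquiv_matrixGrading hT hβ S S' _ _ _ hg
    exact gradedSuperIso_of_map_eq φ hφ

end Odd

/-! ### Graded division algebras yield bicharacter data. -/

section Support

variable {F : Type*} [Field F] [IsAlgClosed F] {H : Type*} [CommGroup H] {D : Type*} [Ring D]
  [Algebra F D] [FiniteDimensional F D] {𝒟 : H → Submodule F D}

/-- The support of a graded division algebra is a subgroup. -/
def IsGradedDivision.support (h𝒟 : IsGradedDivision 𝒟) : Subgroup H where
  carrier := {h | 𝒟 h ≠ ⊥}
  mul_mem' := by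
    intro g h hg hh
    rw [Set.mem_ofPred_eq, Submodule.ne_bot_iff] at *
    obtain ⟨x, hx, hx0⟩ := hg
    obtain ⟨y, hy, hy0⟩ := hh
    exact ⟨x * y, h𝒟.grading.mul_mem _ _ _ _ hx hy, h𝒟.mul_ne_zero hx hx0 hy hy0⟩
  one_mem' := by
    have := h𝒟.nontrivial
    rw [Set.mem_ofPred_eq, Submodule.ne_bot_iff]
    exact ⟨1, h𝒟.grading.one_mem, one_ne_zero⟩
  inv_mem' := by
    intro h hh
    have := h𝒟.nontrivial
    rw [Set.mem_ofPred_eq, Submodule.ne_bot_iff] at *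
    obtain ⟨x, hx, hx0⟩ := hh
    obtain ⟨y, hy, hxy, -⟩ := h𝒟.exists_inverse hx hx0
    refine ⟨y, hy, ?_⟩
    rintro rfl
    rw [mul_zero] at hxy
    exact zero_ne_one hxy

/-- As `H` is abelian, `x * y` and `y * x` lie in the same component, which is at most a line. If
one of the two components is zero the scalar is arbitrary, and `1` is taken. -/
theorem IsGradedDivision.exists_commutation (h𝒟 : IsGradedDivision 𝒟) (s t : H) :
    ∃ c : Fˣ, ∀ x ∈ 𝒟 s, ∀ y ∈ 𝒟 t, x * y = (c : F) • (y * x) := by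
  by_cases hs : ∃ x ∈ 𝒟 s, x ≠ 0
  swap
  · push Not at hs
    exact ⟨1, fun x hx y _ => by simp [hs x hx]⟩
  by_cases ht : ∃ y ∈ 𝒟 t, y ≠ 0
  swap
  · push Not at ht
    exact ⟨1, fun x _ y hy => by simp [ht y hy]⟩
  obtain ⟨x₀, hx₀, hx₀0⟩ := hs
  obtain ⟨y₀, hy₀, hy₀0⟩ := ht
  have h1 := h𝒟.grading.mul_mem _ _ _ _ hy₀ hx₀
  have h2 := h𝒟.grading.mul_mem _ _ _ _ hx₀ hy₀
  rw [mul_comm s t] at h2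
  obtain ⟨c, hc⟩ := h𝒟.eq_smul h1 (h𝒟.mul_ne_zero hy₀ hy₀0 hx₀ hx₀0) h2
  have hc0 : c ≠ 0 := by
    rintro rfl
    exact h𝒟.mul_ne_zero hx₀ hx₀0 hy₀ hy₀0 (by rw [hc, zero_smul])
  refine ⟨Units.mk0 c hc0, fun x hx y hy => ?_⟩
  obtain ⟨a, rfl⟩ := h𝒟.eq_smul hx₀ hx₀0 hx
  obtain ⟨b, rfl⟩ := h𝒟.eq_smul hy₀ hy₀0 hy
  rw [smul_mul_smul_comm, hc, smul_mul_smul_comm, smul_comm, mul_comm a b, Units.val_mk0]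

/-- A finite-dimensional graded division algebra whose homogeneous central elements have trivial
degree is a realization of its support and commutation factor. -/
theorem IsGradedDivision.exists_realization (h𝒟 : IsGradedDivision 𝒟)
    (hcent : ∀ t, ∀ d ∈ 𝒟 t, d ≠ 0 → (∀ e, d * e = e * d) → t = 1) :
    ∃ P : DivisionDatum F H, Nonempty (Realization P 𝒟) := by
  classical
  choose β hβ using h𝒟.exists_commutation
  have hX : ∀ t : h𝒟.support, ∃ x ∈ 𝒟 t, x ≠ 0 := fun t => (Submodule.ne_bot_iff _).1 t.2
  choose X hXm hX0 using hX
  have huniq : ∀ {s t : H} {x y : D} {c d : F}, x ∈ 𝒟 s → x ≠ 0 → y ∈ 𝒟 t → y ≠ 0 →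
      c • (x * y) = d • (x * y) → c = d := fun hx hx0 hy hy0 h =>
    smul_left_injective F (h𝒟.mul_ne_zero hx hx0 hy hy0) h
  have hmul_left : ∀ s s' t : h𝒟.support, β (s * s') t = β s t * β s' t := by
    intro s s' t
    have hss := h𝒟.grading.mul_mem _ _ _ _ (hXm s) (hXm s')
    have hss0 := h𝒟.mul_ne_zero (hXm s) (hX0 s) (hXm s') (hX0 s')
    apply Units.ext
    apply huniq (hXm t) (hX0 t) hss hss0
    rw [← hβ _ _ _ hss _ (hXm t), mul_assoc, hβ _ _ _ (hXm s') _ (hXm t), mul_smul_comm,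
      ← mul_assoc, hβ _ _ _ (hXm s) _ (hXm t), smul_mul_assoc, smul_smul, mul_assoc, Units.val_mul,
      mul_comm (β s t : F)]
  have hmul_right : ∀ s t t' : h𝒟.support, β s (t * t') = β s t * β s t' := by
    intro s t t'
    have htt := h𝒟.grading.mul_mem _ _ _ _ (hXm t) (hXm t')
    have htt0 := h𝒟.mul_ne_zero (hXm t) (hX0 t) (hXm t') (hX0 t')
    apply Units.ext
    apply huniq htt htt0 (hXm s) (hX0 s)
    rw [← hβ _ _ _ (hXm s) _ htt, ← mul_assoc, hβ _ _ _ (hXm s) _ (hXm t), smul_mul_assoc,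
      mul_assoc, hβ _ _ _ (hXm s) _ (hXm t'), mul_smul_comm, smul_smul, mul_assoc, Units.val_mul]
  have hind : LinearIndependent F X := by
    have hi := ((DirectSum.isInternal_submodule_iff_iSupIndep_and_iSup_eq_top _).1
      h𝒟.grading.isInternal).1
    exact (hi.comp Subtype.val_injective).linearIndependent _ hXm hX0
  have hspan : ⊤ ≤ Submodule.span F (Set.range X) := by
    rintro x -
    induction x using internal_induction h𝒟.grading.isInternal with
    | zero => exact zero_mem _
    | hom h x hx =>
      by_cases hx0 : x = 0
      · rw [hx0]; exact zero_mem _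
      have hh : h ∈ h𝒟.support := (Submodule.ne_bot_iff _).2 ⟨x, hx, hx0⟩
      obtain ⟨c, rfl⟩ := h𝒟.eq_smul (hXm ⟨h, hh⟩) (hX0 ⟨h, hh⟩) hx
      exact Submodule.smul_mem _ _ (Submodule.subset_span ⟨_, rfl⟩)
    | add x y hx hy => exact add_mem hx hy
  let b := Module.Basis.mk hind hspan
  have hb : ∀ t, b t = X t := fun t => Module.Basis.mk_apply _ _ _
  have hfin : Finite h𝒟.support := hind.finite
  refine ⟨{ T := h𝒟.support
            finite := hfin
            β := MonoidHom.mk' (fun s => MonoidHom.mk' (fun t => β s t) (hmul_right s))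
              (fun s s' => MonoidHom.ext (hmul_left s s'))
            alternating := ?_
            nondegenerate := ?_ }, ⟨{ X := b
                                      isUnit := ?_
                                      mul := ?_
                                      comm := ?_
                                      span := ?_ }⟩⟩
  · intro t
    change β t t = 1
    apply Units.ext
    apply huniq (hXm t) (hX0 t) (hXm t) (hX0 t)
    rw [← hβ _ _ _ (hXm t) _ (hXm t), Units.val_one, one_smul]
  · intro t ht
    refine Subtype.ext (hcent t _ (hXm t) (hX0 t) fun e => ?_)
    -- An element of the radical of `β` gives a central `X t`, to which the hypothesis on
    -- homogeneous central elements applies.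
    have : LinearMap.mulLeft F (X t) = LinearMap.mulRight F (X t) := by
      refine b.ext fun s => ?_
      rw [hb, LinearMap.mulLeft_apply, LinearMap.mulRight_apply, hβ _ _ _ (hXm t) _ (hXm s)]
      have h1 : β t s = 1 := ht s
      rw [h1, Units.val_one, one_smul]
    exact LinearMap.congr_fun this e
  · intro t
    rw [hb]
    exact h𝒟.isUnit _ _ (hXm t) (hX0 t)
  · intro s t
    rw [hb, hb, hb]
    exact h𝒟.eq_smul (hXm (s * t)) (hX0 _) (h𝒟.grading.mul_mem _ _ _ _ (hXm s) (hXm t))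
  · intro s t
    rw [hb, hb]
    exact hβ _ _ _ (hXm s) _ (hXm t)
  · intro h
    apply le_antisymm
    · intro x hx
      by_cases hx0 : x = 0
      · rw [hx0]; exact zero_mem _
      have hh : h ∈ h𝒟.support := (Submodule.ne_bot_iff _).2 ⟨x, hx, hx0⟩
      obtain ⟨c, rfl⟩ := h𝒟.eq_smul (hXm ⟨h, hh⟩) (hX0 ⟨h, hh⟩) hx
      exact Submodule.smul_mem _ _ (Submodule.subset_span ⟨⟨h, hh⟩, rfl, hb _⟩)
    · rw [Submodule.span_le]
      rintro _ ⟨t, rfl, rfl⟩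
      rw [hb]
      exact hXm t

end Support

/-! ### Every odd grading of a central algebra comes from a triple. -/

section Classification

variable {F : Type u} [Field F]

/-- Right multiplication by a central `d` commutes with all endomorphisms, so it is a scalar;
evaluating on a basis vector shows that `d` itself is a scalar. -/
theorem degree_eq_one_of_central {H : Type*} [CommGroup H] {D : Type*} [Ring D] [Algebra F D]
    {𝒟 : H → Submodule F D} (h𝒟 : IsGradedDivision 𝒟)
    {U : Type*} [AddCommGroup U] [Module F U] [Module Dᵐᵒᵖ U] [IsScalarTower F Dᵐᵒᵖ U]
    [Algebra.IsCentral F (Module.End Dᵐᵒᵖ U)] {k : Type*} [Nonempty k]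
    (b : Module.Basis k Dᵐᵒᵖ U) {t : H} {d : D} (hd : d ∈ 𝒟 t) (hd0 : d ≠ 0)
    (hcomm : ∀ e, d * e = e * d) : t = 1 := by
  classical
  obtain ⟨i⟩ := ‹Nonempty k›
  let ρ : Module.End Dᵐᵒᵖ U :=
    { toFun := fun x => MulOpposite.op d • x
      map_add' := fun x y => smul_add _ x y
      map_smul' := by
        intro a x
        rw [RingHom.id_apply, smul_smul, smul_smul]
        congr 1
        exact MulOpposite.unop_injective (hcomm _).symm }
  have hρ : ρ ∈ Subalgebra.center F (Module.End Dᵐᵒᵖ U) := by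
    rw [Subalgebra.mem_center_iff]
    intro f
    ext x
    exact map_smul f (MulOpposite.op d) x
  obtain ⟨c, hc⟩ := Algebra.mem_bot.1 (Algebra.IsCentral.out hρ)
  have h1 : MulOpposite.op d • b i = c • b i := by
    have := LinearMap.congr_fun hc (b i)
    rw [Module.algebraMap_end_apply] at this
    exact this.symm
  have h2 : d = c • 1 := by
    have := congrArg (b.coord i) h1
    rw [map_smul, ← one_smul Dᵐᵒᵖ (b i), ← smul_assoc, map_smul, Module.Basis.coord_apply,
      b.repr_self, Finsupp.single_eq_same] at this
    have := congrArg MulOpposite.unop this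
    simpa using this
  by_contra ht
  apply hd0
  rw [← component_self h𝒟.grading.isInternal hd]
  exact component_ne _ (h2 ▸ Submodule.smul_mem _ _ h𝒟.grading.one_mem) (Ne.symm ht)

/-- Odd gradings of central algebras are the gradings `Γ(T, β, γ)`. -/
theorem IsOddGrading.exists_algEquiv_oddSharp [IsAlgClosed F] {G : Type v} [CommGroup G]
    {A : Type u} [Ring A] [Algebra F A] [Nontrivial A] [Algebra.IsCentral F A] {par : ZMod 2 → Submodule F A}
    {𝒜 : G → Submodule F A} (h : IsOddGrading par 𝒜) :
    ∃ (Q : OddDatum F G) (S : Polarization Q.toDivisionDatum)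
      (φ : A ≃ₐ[F] Matrix (Fin Q.k × S.B) (Fin Q.k × S.B) F),
      ∀ x, (sharpGrading par 𝒜 x).map φ.toLinearMap = oddSharp Q S x := by
  obtain ⟨-, D, _, _, _, U, _, _, _, _, _, 𝒟, 𝒰, h𝒟, h𝒰, hodd, φ, hφ⟩ := h
  obtain ⟨k, b, γ, hb⟩ := h𝒰.exists_homogeneous_basis h𝒟
  have hcentral : Algebra.IsCentral F (Module.End Dᵐᵒᵖ U) := Algebra.IsCentral.of_algEquiv F _ _ φ
  have hU : Nontrivial U := by
    by_contra hU
    rw [not_nontrivial_iff_subsingleton] at hU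
    have : Nontrivial (Module.End Dᵐᵒᵖ U) := φ.injective.nontrivial
    exact not_subsingleton (Module.End Dᵐᵒᵖ U) ⟨fun f g => by ext x; exact Subsingleton.elim _ _⟩
  have hk : Nonempty (Fin k) := by
    by_contra hk
    rw [not_nonempty_iff] at hk
    exact not_subsingleton U b.repr.toEquiv.subsingleton
  obtain ⟨P, ⟨R⟩⟩ := h𝒟.exists_realization fun t d hd hd0 hcomm =>
    degree_eq_one_of_central h𝒟 b hd hd0 hcomm
  obtain ⟨t₀, ht₀⟩ : ∃ t : P.T, (t : Sharp G).2 = Multiplicative.ofAdd (1 : ZMod 2) := by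
    rw [parityComponents, Ne, iSup_eq_bot] at hodd
    push Not at hodd
    obtain ⟨g, hg⟩ := hodd
    exact ⟨⟨_, R.component_ne_bot_iff.1 hg⟩, rfl⟩
  -- Basis vectors of odd degree are multiplied by an odd unit, so all new degrees lie in `G`.
  let e : Fin k → P.T := fun i => if (γ i).2 = 1 then 1 else t₀
  have he : ∀ i, (γ i * e i).2 = 1 := by
    intro i
    simp only [e]
    split_ifs with hi
    · simpa using hi
    · rw [Prod.snd_mul, (zmod_two_cases (γ i).2).resolve_left hi, ht₀]
      decide
  let b' := b.isUnitSMul (w := fun i => MulOpposite.op (R.X (e i))) fun i => (R.isUnit _).op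
  let Q : OddDatum F G :=
    { toDivisionDatum := P
      not_even := fun hle => by
        have : (t₀ : Sharp G).2 = 1 := hle t₀.2
        rw [ht₀] at this
        exact absurd this (by decide)
      k := k
      k_pos := Fin.pos_iff_nonempty.2 hk
      γ := fun i => (γ i * e i).1 }
  have hb' : ∀ i, b' i ∈ 𝒰 (Q.γSharp i) := by
    intro i
    have h1 := h𝒰.smul_mem _ _ _ _ (hb i) (R.X_mem (e i))
    have h2 : Q.γSharp i = γ i * e i := Prod.ext rfl (he i).symm
    rw [h2, Module.Basis.isUnitSMul_apply]
    exact h1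
  obtain ⟨S⟩ := P.nonempty_polarization
  obtain ⟨Φ, hΦ⟩ := exists_end_algEquiv_matrix R S h𝒰 b' hb'
  refine ⟨Q, S, φ.trans Φ, fun x => ?_⟩
  rw [oddSharp, ← hΦ, ← hφ]
  exact Submodule.map_comp φ.toLinearMap Φ.toLinearMap _

end Classification

/-! ### Involutions and the canonical parity of matrix superalgebras. -/

section Involution

variable {F : Type*} [Field F]

/-- A matrix involution that anticommutes with an invertible matrix is conjugate to a diagonal
matrix with equally many entries `1` and `-1`. -/
theorem exists_algEquiv_involution (h2 : (2 : F) ≠ 0) {ι : Type*} [Fintype ι] [DecidableEq ι]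
    (Z W : Matrix ι ι F) (hZ : Z * Z = 1) (hW : IsUnit W) (hZW : Z * W = -(W * Z)) :
    ∃ (n : ℕ) (ψ : Matrix ι ι F ≃ₐ[F] Matrix (Fin n ⊕ Fin n) (Fin n ⊕ Fin n) F),
      2 * n = Fintype.card ι ∧
        ψ Z = Matrix.diagonal (Sum.elim (fun _ => 1) (fun _ => -1)) := by
  let L : Module.End F (ι → F) := Matrix.toLinAlgEquiv' Z
  let M : Module.End F (ι → F) := Matrix.toLinAlgEquiv' W
  have hL : ∀ x, L (L x) = x := by
    intro x
    rw [← Module.End.mul_apply, ← map_mul, hZ, map_one, Module.End.one_apply]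
  have hM : Function.Injective M :=
    ((Module.End.isUnit_iff _).1 (hW.map Matrix.toLinAlgEquiv')).1
  have hLM : ∀ x, L (M x) = -M (L x) := by
    intro x
    rw [← Module.End.mul_apply, ← map_mul, hZW, map_neg, map_mul]
    rfl
  let V₁ : Submodule F (ι → F) := LinearMap.ker (L - 1)
  let V₂ : Submodule F (ι → F) := LinearMap.ker (L + 1)
  have hV₁ : ∀ x, x ∈ V₁ ↔ L x = x := by
    intro x
    simp [V₁, sub_eq_zero]
  have hV₂ : ∀ x, x ∈ V₂ ↔ L x = -x := by
    intro x
    simp [V₂, eq_neg_iff_add_eq_zero]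
  have hcompl : IsCompl V₁ V₂ := by
    constructor
    · rw [Submodule.disjoint_def]
      intro x hx hx'
      rw [hV₁] at hx
      rw [hV₂, hx, eq_neg_iff_add_eq_zero, ← two_smul F, smul_eq_zero] at hx'
      exact hx'.resolve_left h2
    · rw [codisjoint_iff, eq_top_iff]
      rintro x -
      rw [Submodule.mem_sup]
      refine ⟨(2 : F)⁻¹ • (x + L x), ?_, (2 : F)⁻¹ • (x - L x), ?_, ?_⟩
      · rw [hV₁, map_smul, map_add, hL, add_comm]
      · rw [hV₂, map_smul, map_sub, hL, ← smul_neg, neg_sub]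
      · rw [← smul_add, add_add_sub_cancel, ← two_smul F, smul_smul, inv_mul_cancel₀ h2, one_smul]
  -- Anticommutation makes `M` exchange the two eigenspaces of `L`, which therefore have equal
  -- dimension.
  have hM₁ : V₁.map M ≤ V₂ := by
    rintro _ ⟨x, hx, rfl⟩
    rw [SetLike.mem_coe, hV₁] at hx
    rw [hV₂, hLM, hx]
  have hM₂ : V₂.map M ≤ V₁ := by
    rintro _ ⟨x, hx, rfl⟩
    rw [SetLike.mem_coe, hV₂] at hx
    rw [hV₁, hLM, hx, map_neg, neg_neg]
  have hdim : Module.finrank F V₂ = Module.finrank F V₁ := by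
    apply le_antisymm
    · rw [(Submodule.equivMapOfInjective M hM V₂).finrank_eq]
      exact Submodule.finrank_mono hM₂
    · rw [(Submodule.equivMapOfInjective M hM V₁).finrank_eq]
      exact Submodule.finrank_mono hM₁
  let b : Module.Basis (Fin (Module.finrank F V₁) ⊕ Fin (Module.finrank F V₁)) F (ι → F) :=
    ((Module.finBasis F V₁).prod (Module.finBasisOfFinrankEq F V₂ hdim)).map
      (Submodule.prodEquivOfIsCompl V₁ V₂ hcompl)
  refine ⟨_, Matrix.toLinAlgEquiv'.trans (LinearMap.toMatrixAlgEquiv b), ?_, ?_⟩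
  · have := Module.finrank_eq_card_basis b
    rw [Module.finrank_fintype_fun_eq_card, Fintype.card_sum, Fintype.card_fin] at this
    rw [this, two_mul]
  · rw [AlgEquiv.trans_apply]
    change LinearMap.toMatrixAlgEquiv b L = _
    have hb₁ : ∀ i, L (b (Sum.inl i)) = b (Sum.inl i) := by
      intro i
      rw [← hV₁]
      simp [b]
    have hb₂ : ∀ i, L (b (Sum.inr i)) = -b (Sum.inr i) := by
      intro i
      rw [← hV₂]
      simp [b]
    ext i j
    rw [LinearMap.toMatrixAlgEquiv_apply, Matrix.diagonal_apply]
    rcases j with j | j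
    · rw [hb₁, b.repr_self, Finsupp.single_apply]
      simp only [eq_comm (a := i)]
      split_ifs with h
      · rw [← h]; rfl
      · rfl
    · rw [hb₂, map_neg, b.repr_self, Finsupp.neg_apply, Finsupp.single_apply]
      simp only [eq_comm (a := i)]
      split_ifs with h
      · rw [← h]; rfl
      · simp

variable (F) in
theorem disjoint_canonicalParity (m n : ℕ) :
    Disjoint (canonicalParity F m n 0) (canonicalParity F m n 1) := by
  rw [Submodule.disjoint_def]
  intro M h0 h1
  ext a b
  by_cases h : indexParity m n a - indexParity m n b = 0
  · exact h1 a b (by rw [h]; exact zero_ne_one)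
  · exact h0 a b h

/-- Entrywise, the commutation relation gives `x = -x` for every entry of the wrong parity. -/
theorem mem_canonicalParity_of_commutation (h2 : (2 : F) ≠ 0) {n : ℕ}
    (M : MatrixSuperalgebra F n n) (i : ZMod 2)
    (h : Matrix.diagonal (Sum.elim (fun _ : Fin n => (1 : F)) (fun _ : Fin n => -1)) * M =
      (if i = 0 then 1 else -1 : F) •
        (M * Matrix.diagonal (Sum.elim (fun _ : Fin n => (1 : F)) (fun _ : Fin n => -1)))) :
    M ∈ canonicalParity F n n i := by
  intro a b hab
  have h := congrFun (congrFun h a) b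
  rw [Matrix.diagonal_mul, Matrix.smul_apply, Matrix.mul_diagonal, smul_eq_mul] at h
  have hx : ∀ x : F, x = -x → x = 0 := by
    intro x hx
    have : 2 * x = 0 := by linear_combination hx
    exact (mul_eq_zero.1 this).resolve_left h2
  have hx' : ∀ x : F, -x = x → x = 0 := fun x hxx => hx x hxx.symm
  have hcases : ∀ j : ZMod 2, j = 0 ∨ j = 1 := by decide
  rcases a with a | a <;> rcases b with b | b <;> obtain rfl | rfl := hcases i <;>
    simp [indexParity] at h hab <;> first | exact hx _ h | exact hx' _ h

/-- With zero diagonal blocks, each off-diagonal block has a one-sided inverse; comparing ranks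
gives both inequalities. -/
theorem eq_of_isUnit_of_mem_canonicalParity {m n : ℕ} {M : MatrixSuperalgebra F m n}
    (hM : IsUnit M) (h : M ∈ canonicalParity F m n 1) : m = n := by
  have h₁₁ : M.toBlocks₁₁ = 0 := by
    ext i j
    exact h _ _ (by simp [indexParity])
  have h₂₂ : M.toBlocks₂₂ = 0 := by
    ext i j
    exact h _ _ (by simp [indexParity])
  obtain ⟨N, hN, -⟩ := isUnit_iff_exists.1 hM
  rw [← Matrix.fromBlocks_toBlocks M, ← Matrix.fromBlocks_toBlocks N, h₁₁, h₂₂,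
    Matrix.fromBlocks_multiply, ← Matrix.fromBlocks_one, Matrix.fromBlocks_inj] at hN
  obtain ⟨h1, -, -, h2⟩ := hN
  have key : ∀ {p q : ℕ} (B : Matrix (Fin p) (Fin q) F) (C : Matrix (Fin q) (Fin p) F),
      B * C = 1 → p ≤ q := by
    intro p q B C hBC
    have := (Matrix.rank_mul_le_left B C).trans (Matrix.rank_le_width B)
    rwa [hBC, Matrix.rank_one, Fintype.card_fin] at this
  apply le_antisymm
  · exact key _ _ (by simpa using h1)
  · exact key _ _ (by simpa using h2)

end Involution

/-! ### The superalgebra underlying `Γ(T, β, γ)` is `M(n,n)`. -/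

section ParityModel

variable {F : Type*} [Field F] {G : Type*} [CommGroup G] (Q : OddDatum F G)

/-- `T` maps onto `ℤ₂`, so it contains an element `s` of order 2. In characteristic 2 the only
square root of unity is `1`, so `β(s, ·)` would be trivial, against nondegeneracy. -/
theorem OddDatum.two_ne_zero (Q : OddDatum F G) : (2 : F) ≠ 0 := by
  intro h2
  have := Q.finite
  have hsq : ∀ u : Fˣ, u ^ 2 = 1 → u = 1 := by
    intro u hu
    apply Units.ext
    have hu' : (u : F) ^ 2 = 1 := by
      rw [← Units.val_pow_eq_pow_val, hu, Units.val_one]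
    have h0 : ((u : F) - 1) ^ 2 = 0 := by linear_combination hu' - (u - 1) * h2
    rw [Units.val_one]
    exact sub_eq_zero.1 (pow_eq_zero_iff (n := 2) (by norm_num) |>.1 h0)
  have hdvd : 2 ∣ Nat.card Q.T := by
    let f : Q.T →* Multiplicative (ZMod 2) := (MonoidHom.snd G _).comp Q.T.subtype
    have hf : Function.Surjective f := by
      intro x
      rcases zmod_two_cases x with rfl | rfl
      · exact ⟨1, map_one f⟩
      · exact Q.exists_odd
    have := Subgroup.card_dvd_of_surjective f hf
    simpa using this
  have : Fact (Nat.Prime 2) := ⟨Nat.prime_two⟩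
  obtain ⟨s, hs⟩ := exists_prime_orderOf_dvd_card' 2 hdvd
  have hs2 : s ^ 2 = 1 := by
    have := pow_orderOf_eq_one s
    rwa [hs] at this
  have h1 : s = 1 := by
    apply Q.nondegenerate
    intro t
    apply hsq
    rw [← MonoidHom.pow_apply, ← map_pow, hs2, map_one, MonoidHom.one_apply]
  rw [h1, orderOf_one] at hs
  exact absurd hs (by decide)

/-- The nontrivial character of `ℤ₂` with values `1` and `-1`. -/
def signCharacter (F : Type*) [Field F] : Multiplicative (ZMod 2) →* Fˣ where
  toFun x := if x = 1 then 1 else -1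
  map_one' := by simp
  map_mul' x y := by
    have h : ¬ Multiplicative.ofAdd (1 : ZMod 2) = 1 := by decide
    have h' : Multiplicative.ofAdd (1 : ZMod 2) * Multiplicative.ofAdd (1 : ZMod 2) = 1 := by decide
    rcases zmod_two_cases x with rfl | rfl <;> rcases zmod_two_cases y with rfl | rfl <;>
      simp only [h', one_mul, mul_one, if_true, if_neg h, neg_mul_neg]

/-- Nondegeneracy makes `β` injective from `T` to its characters, and Dedekind independence bounds
the number of characters by `|T|`. -/
theorem DivisionDatum.beta_surjective {F H : Type*} [Field F] [CommGroup H]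
    (P : DivisionDatum F H) : Function.Surjective P.β := by
  have := P.finite
  have hfin : Finite (P.T →* Fˣ) := by
    have h := (linearIndependent_monoidHom P.T F).comp
      (fun f : P.T →* Fˣ => (Units.coeHom F).comp f)
      (fun f g hfg => by
        ext t
        exact DFunLike.congr_fun hfg t)
    exact h.finite
  refine (Function.Injective.bijective_of_nat_card_le ?_
    (card_le_of_pairing (MonoidHom.id (P.T →* Fˣ)) Function.injective_id)).2
  rw [injective_iff_map_eq_one]
  exact fun t ht => P.nondegenerate t fun s => DFunLike.congr_fun ht s

variable (S : Polarization Q.toDivisionDatum)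

/-- The parity character is represented by `t` through `β`, so parity becomes an inner automorphism;
its square is trivial, hence so is that of `t`. -/
theorem exists_parity_element : ∃ t : Q.T, t * t = 1 ∧
    ∀ s : Q.T, Q.β t s = signCharacter F (s : Sharp G).2 := by
  obtain ⟨t, ht⟩ := Q.beta_surjective
    ((signCharacter F).comp ((MonoidHom.snd G _).comp Q.T.subtype))
  have ht' : ∀ s : Q.T, Q.β t s = signCharacter F (s : Sharp G).2 := fun s =>
    DFunLike.congr_fun ht s
  refine ⟨t, Q.nondegenerate _ fun s => ?_, ht'⟩
  rw [map_mul, MonoidHom.mul_apply, ht', ← map_mul]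
  rcases zmod_two_cases (s : Sharp G).2 with h | h <;> rw [h]
  · simp
  · rw [show Multiplicative.ofAdd (1 : ZMod 2) * Multiplicative.ofAdd (1 : ZMod 2) = 1 by decide,
      map_one]

theorem scalarX_mul_of_mem {t : Q.T}
    (ht : ∀ s : Q.T, Q.β t s = signCharacter F (s : Sharp G).2) {h : Sharp G}
    {M : Matrix (Fin Q.k × S.B) (Fin Q.k × S.B) F} (hM : M ∈ oddSharp Q S h) :
    scalarX S Q.k t * M = (signCharacter F h.2 : F) • (M * scalarX S Q.k t) := by
  obtain ⟨M, rfl⟩ := (Matrix.compAlgEquiv (Fin Q.k) S.B F F).surjective M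
  rw [oddSharp, mem_matrixGrading_iff] at hM
  rw [scalarX, ← map_mul, ← map_mul, ← map_smul]
  congr 1
  ext1 i j
  rw [Matrix.smul_apply, Matrix.scalar_apply, Matrix.diagonal_mul, Matrix.mul_diagonal]
  by_cases h0 : M i j = 0
  · simp [h0]
  obtain ⟨s, c, hs, -, hc⟩ := (standardRealization S).mem_component (hM i j) h0
  have := (standardRealization S).comm t s
  -- The entries of `γ` lie in `G` and do not affect parity.
  have hdeg : (s : Sharp G).2 = h.2 := by
    rw [hs]
    simp [OddDatum.γSharp]
  rw [hc, mul_smul_comm, this, smul_mul_assoc, smul_comm, ht, hdeg]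

theorem scalarX_mul_of_mem_parity {t : Q.T}
    (ht : ∀ s : Q.T, Q.β t s = signCharacter F (s : Sharp G).2) {i : ZMod 2}
    {M : Matrix (Fin Q.k × S.B) (Fin Q.k × S.B) F} (hM : M ∈ oddParity Q S i) :
    scalarX S Q.k t * M =
      (signCharacter F (Multiplicative.ofAdd i) : F) • (M * scalarX S Q.k t) := by
  refine Submodule.iSup_induction (fun g => oddSharp Q S (g, Multiplicative.ofAdd i))
    (motive := fun M => scalarX S Q.k t * M =
      (signCharacter F (Multiplicative.ofAdd i) : F) • (M * scalarX S Q.k t)) hM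
    (fun g M hM => scalarX_mul_of_mem Q S ht hM) (by simp) (fun M N hM hN => ?_)
  rw [mul_add, hM, hN, add_mul, smul_add]

/-- The superalgebra underlying `Γ(T, β, γ)` is isomorphic to some `M(n, n)`. -/
theorem exists_algEquiv_canonicalParity [IsAlgClosed F] :
    ∃ (n : ℕ) (ψ : Matrix (Fin Q.k × S.B) (Fin Q.k × S.B) F ≃ₐ[F] MatrixSuperalgebra F n n),
      2 * n = Q.k * Nat.card S.B ∧
        ∀ i, (oddParity Q S i).map ψ.toLinearMap = canonicalParity F n n i := by
  obtain ⟨t, htt, ht⟩ := exists_parity_element Q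
  obtain ⟨w, hw⟩ := Q.exists_odd
  obtain ⟨c, hc⟩ := exists_scalarX_mul_self S Q.k htt
  -- Dividing `1 ⊗ X_t` by a square root of the scalar `c` makes it an involution.
  obtain ⟨r, hr⟩ := IsAlgClosed.exists_pow_nat_eq (c : F) (n := 2) (by norm_num)
  have hr0 : r ≠ 0 := by
    rintro rfl
    exact c.ne_zero (by rw [← hr]; norm_num)
  have hcomm : ∀ {i : ZMod 2} {M}, M ∈ oddParity Q S i → (r⁻¹ • scalarX S Q.k t) * M =
      (signCharacter F (Multiplicative.ofAdd i) : F) • (M * (r⁻¹ • scalarX S Q.k t)) := by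
    intro i M hM
    rw [smul_mul_assoc, scalarX_mul_of_mem_parity Q S ht hM, mul_smul_comm, smul_comm]
  have hsign : ∀ i : ZMod 2, (signCharacter F (Multiplicative.ofAdd i) : F) =
      if i = 0 then 1 else -1 := by
    intro i
    have hcases : ∀ j : ZMod 2, j = 0 ∨ j = 1 := by decide
    obtain rfl | rfl := hcases i
    · simp
    · simp [signCharacter]
  have hwm : scalarX S Q.k w ∈ oddParity Q S 1 := by
    refine Submodule.mem_iSup_of_mem (w : Sharp G).1 ?_
    rw [← hw]
    exact scalarX_mem S Q.γSharp w
  obtain ⟨n, ψ, hn, hψ⟩ := exists_algEquiv_involution Q.two_ne_zero (r⁻¹ • scalarX S Q.k t)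
    (scalarX S Q.k w) (by
      rw [smul_mul_smul_comm, hc, smul_smul, ← hr]
      have : r⁻¹ * r⁻¹ * r ^ 2 = 1 := by field_simp
      rw [this, one_smul]) (isUnit_scalarX S Q.k w) (by
      rw [hcomm hwm, hsign, if_neg one_ne_zero, neg_one_smul])
  refine ⟨n, ψ, ?_, ?_⟩
  · rw [hn, Fintype.card_prod, Fintype.card_fin, Nat.card_eq_fintype_card]
  have hle : ∀ i, (oddParity Q S i).map ψ.toLinearMap ≤ canonicalParity F n n i := by
    rintro i _ ⟨M, hM, rfl⟩
    apply mem_canonicalParity_of_commutation Q.two_ne_zero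
    have := congrArg ψ (hcomm hM)
    rw [map_smul, map_mul, map_mul, hψ, hsign] at this
    exact this
  -- The transported parts span everything and lie in the disjoint canonical parts, so the
  -- inclusions are equalities.
  have hsup : ∀ M : MatrixSuperalgebra F n n, ∃ y ∈ (oddParity Q S 0).map ψ.toLinearMap,
      ∃ z ∈ (oddParity Q S 1).map ψ.toLinearMap, y + z = M := by
    intro M
    obtain ⟨N, rfl⟩ := ψ.surjective M
    rw [← Submodule.mem_sup, ← Submodule.map_sup, oddParity_sup_eq_top]
    exact ⟨N, trivial, rfl⟩
  have hdisj := Submodule.disjoint_def.1 (disjoint_canonicalParity F n n)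
  intro i
  apply le_antisymm (hle i)
  intro M hM
  obtain ⟨y, hy, z, hz, rfl⟩ := hsup M
  have hcases : ∀ j : ZMod 2, j = 0 ∨ j = 1 := by decide
  obtain rfl | rfl := hcases i
  · rw [hdisj z ((Submodule.add_mem_iff_right _ (hle 0 hy)).1 hM) (hle 1 hz), add_zero]
    exact hy
  · rw [hdisj y (hle 0 hy) ((Submodule.add_mem_iff_left _ (hle 1 hz)).1 hM), zero_add]
    exact hz

end ParityModel

/-! ### Transport of gradings along algebra isomorphisms. -/

section Transport

variable {F : Type*} [Field F] {A B : Type*} [Ring A] [Algebra F A] [Ring B] [Algebra F B]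
  {G : Type*} [CommGroup G]

theorem IsGrading.map {𝒜 : G → Submodule F A} (h : IsGrading 𝒜) (φ : A ≃ₐ[F] B) :
    IsGrading fun g => (𝒜 g).map φ.toLinearMap := by
  classical
  constructor
  · have hi := (DirectSum.isInternal_submodule_iff_iSupIndep_and_iSup_eq_top _).1 h.isInternal
    refine @(DirectSum.isInternal_submodule_iff_iSupIndep_and_iSup_eq_top _).2 ⟨?_, ?_⟩
    · exact hi.1.map_orderIso (Submodule.orderIsoMapComap φ.toLinearEquiv)
    · rw [← Submodule.map_iSup, hi.2, Submodule.map_top]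
      exact LinearMap.range_eq_top.2 φ.surjective
  · rintro g h' _ _ ⟨a, ha, rfl⟩ ⟨b, hb, rfl⟩
    exact ⟨a * b, h.mul_mem _ _ _ _ ha hb, map_mul φ a b⟩

theorem IsSuperalgebraGrading.map {par : ZMod 2 → Submodule F A} {𝒜 : G → Submodule F A}
    (h : IsSuperalgebraGrading par 𝒜) (φ : A ≃ₐ[F] B) :
    IsSuperalgebraGrading (fun i => (par i).map φ.toLinearMap)
      (fun g => (𝒜 g).map φ.toLinearMap) := by
  refine ⟨h.grading.map φ, fun g => ?_⟩
  rw [← Submodule.map_inf φ.toLinearMap φ.injective, ← Submodule.map_inf φ.toLinearMap φ.injective,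
    ← Submodule.map_sup, ← h.compatible]

theorem sharpGrading_map {I : Type*} (par : ZMod 2 → Submodule F A) (𝒜 : I → Submodule F A)
    (φ : A ≃ₐ[F] B)
    (x : Sharp I) :
    sharpGrading (fun i => (par i).map φ.toLinearMap) (fun g => (𝒜 g).map φ.toLinearMap) x =
      (sharpGrading par 𝒜 x).map φ.toLinearMap :=
  (Submodule.map_inf φ.toLinearMap φ.injective).symm

end Transport

/-! ### Each `Γ(T, β, γ)` is an odd grading. -/

section Existence

variable {F : Type u} [Field F] [IsAlgClosed F] {G : Type v} [CommGroup G]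

/-- A copy of `Γ(T, β, γ)` on a superalgebra in the universe of the field is an odd grading. -/
theorem isOddGrading_of_algEquiv (Q : OddDatum F G) (S : Polarization Q.toDivisionDatum)
    {A : Type u} [Ring A] [Algebra F A]
    (ψ : Matrix (Fin Q.k × S.B) (Fin Q.k × S.B) F ≃ₐ[F] A) :
    IsOddGrading (fun i => (oddParity Q S i).map ψ.toLinearMap)
      (fun g => (oddGrading Q S g).map ψ.toLinearMap) := by
  refine ⟨(isSuperalgebraGrading_odd Q S).map ψ, ?_⟩
  -- Reindexing by `Fin` puts the division algebra in the universe of `F`, as `IsOddGrading`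
  -- demands; `S.B` lives in the universe of `G`.
  obtain ⟨D, _, _, 𝒟, ⟨R⟩⟩ : ∃ (D : Type u) (_ : Ring D) (_ : Algebra F D)
      (𝒟 : Sharp G → Submodule F D), Nonempty (Realization Q.toDivisionDatum 𝒟) :=
    ⟨Matrix (Fin (Fintype.card S.B)) (Fin (Fintype.card S.B)) F, inferInstance, inferInstance,
      _, ⟨(standardRealization S).map (Matrix.reindexAlgEquiv F F (Fintype.equivFin S.B))⟩⟩
  have := R.finiteDimensional
  have h𝒟 := R.isGradedDivision
  have h𝒰 := isGradedRightModule_freeGrading h𝒟.grading Q.γSharp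
  obtain ⟨Φ, hΦ⟩ := exists_end_algEquiv_matrix R S h𝒰 (Pi.basisFun _ _)
    (basisFun_mem_freeGrading h𝒟.grading Q.γSharp)
  refine ⟨D, inferInstance, inferInstance, inferInstance, Fin Q.k → Dᵐᵒᵖ, inferInstance,
    inferInstance, inferInstance, inferInstance, inferInstance, 𝒟, freeGrading 𝒟 Q.γSharp,
    h𝒟, h𝒰, ?_,
    ψ.symm.trans Φ.symm, fun x => ?_⟩
  · obtain ⟨t, ht⟩ := Q.exists_odd
    intro hbot
    refine R.component_ne_bot_iff.2 t.2 ?_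
    rw [eq_bot_iff, ← hbot, parityComponents]
    refine le_trans (le_of_eq ?_) (le_iSup _ (t : Sharp G).1)
    rw [← ht]
  · have key : ∀ f, Φ f ∈ oddSharp Q S x ↔ f ∈ endComponent (D := D) (freeGrading 𝒟 Q.γSharp) x := by
      intro f
      have := AlgEquiv.apply_mem_map_iff Φ (endComponent (D := D) (freeGrading 𝒟 Q.γSharp) x) f
      rwa [hΦ] at this
    rw [sharpGrading_map, sharpGrading_odd]
    ext f
    obtain ⟨M, rfl⟩ := (ψ.symm.trans Φ.symm).surjective f
    rw [AlgEquiv.apply_mem_map_iff, ← key]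
    obtain ⟨N, rfl⟩ := ψ.surjective M
    rw [AlgEquiv.apply_mem_map_iff, AlgEquiv.trans_apply, AlgEquiv.symm_apply_apply,
      AlgEquiv.apply_symm_apply]

end Existence

end SuperGrading

end

/-! ### Assembly of the three statements. -/

theorem mainTheorem4 (F : Type u) [Field F] [IsAlgClosed F] (G : Type v) [CommGroup G] :
    -- every odd grading on `M(m,n)` is isomorphic to some `Γ(T,β,γ)`, and forces `m = n`
    (∀ (m n : ℕ), 0 < m + n → ∀ 𝒜 : G → Submodule F (MatrixSuperalgebra F m n),
      IsOddGrading (canonicalParity F m n) 𝒜 →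
        m = n ∧ ∃ (Q : OddDatum F G) (S : Polarization Q.toDivisionDatum),
          GradedSuperIso (canonicalParity F m n) 𝒜 (oddParity Q S) (oddGrading Q S)) ∧
    -- every `Γ(T,β,γ)` exists and is an odd grading on some `M(n,n)`, with `2n = k √|T|`
    (∀ Q : OddDatum F G, Nonempty (Polarization Q.toDivisionDatum) ∧
      ∀ S : Polarization Q.toDivisionDatum, ∃ n : ℕ, (2 * n) ^ 2 = Q.k ^ 2 * Nat.card Q.T ∧
        ∃ 𝒜 : G → Submodule F (MatrixSuperalgebra F n n),
          IsOddGrading (canonicalParity F n n) 𝒜 ∧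
          GradedSuperIso (canonicalParity F n n) 𝒜 (oddParity Q S) (oddGrading Q S)) ∧
    -- the isomorphism criterion
    (∀ (Q Q' : OddDatum F G) (S : Polarization Q.toDivisionDatum)
      (S' : Polarization Q'.toDivisionDatum),
      GradedSuperIso (oddParity Q S) (oddGrading Q S) (oddParity Q' S') (oddGrading Q' S') ↔
        ∃ hT : Q.T = Q'.T,
          (∀ s t : Q.T, Q.β s t = Q'.β ⟨s, hT ▸ s.2⟩ ⟨t, hT ▸ t.2⟩) ∧
          ∃ g : G,
            (cosetMultiset Q.T Q.γSharp).map (fun c => ((g, 1) : Sharp G) • c) =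
              cosetMultiset Q.T Q'.γSharp) := by
  refine ⟨fun m n hmn 𝒜 h𝒜 => ?_, fun Q => ⟨Q.nonempty_polarization, fun S => ?_⟩,
    fun Q Q' S S' => gradedSuperIso_odd_iff Q Q' S S'⟩
  · have : Nonempty (Fin m ⊕ Fin n) := by
      rw [← Fintype.card_pos_iff, Fintype.card_sum, Fintype.card_fin, Fintype.card_fin]
      exact hmn
    obtain ⟨Q, S, φ, hφ⟩ := h𝒜.exists_algEquiv_oddSharp
    have hiso := gradedSuperIso_of_map_eq φ hφ
    rw [groupComponents_sharpGrading h𝒜.1,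
      parityComponents_sharpGrading h𝒜.1 (disjoint_canonicalParity F m n)] at hiso
    refine ⟨?_, Q, S, hiso⟩
    -- The unit `1 ⊗ X_t` with `t` odd pulls back to an odd invertible matrix of `M(m,n)`, which
    -- forces `m = n`.
    obtain ⟨t, ht⟩ := Q.exists_odd
    have hmem := scalarX_mem S Q.γSharp t
    rw [← oddSharp, ← hφ] at hmem
    obtain ⟨M, hM, hMt⟩ := hmem
    refine eq_of_isUnit_of_mem_canonicalParity (M := M) ?_ ?_
    · have hu := (isUnit_scalarX S Q.k t).map φ.symm
      rw [← hMt] at hu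
      simpa using hu
    · have := hM.2
      rwa [ht] at this
  · obtain ⟨n, ψ, hn, hψ⟩ := exists_algEquiv_canonicalParity Q S
    have hodd := isOddGrading_of_algEquiv Q S ψ
    rw [funext hψ] at hodd
    refine ⟨n, by rw [hn, mul_pow, S.card_T], _, hodd, ψ.symm, fun i => ?_, fun g => ?_⟩
    · rw [← hψ, ← Submodule.map_comp]
      convert Submodule.map_id _
      ext1 x
      exact ψ.symm_apply_apply x
    · rw [← Submodule.map_comp]
      convert Submodule.map_id _
      ext1 x
      exact ψ.symm_apply_apply x
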